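/- **Conventions.** Graphs are simple. For a finite graph $H$ with edge weights $(w_e)$, $\mathcal M_H$ denotes the matching (set of pairwise disjoint edges) of $H$ of maximum total weight $\sum_{e\in M}w_e$; throughout, the weights are i.i.d. nonnegative random variables whose common law $\nu$ has no atoms, so that $\mathcal M_H$ is almost surely unique. For a locally finite connected graph $G$, $e\in E(G)$ and $r\ge 0$, let $\mathbb B_e^r(G)$ be the subgraph of $G$ induced by the vertices at graph distance at most $r$ from an endpoint of $e$, and for a subgraph $H$ of $G$ let $\partial H$ be the set of vertices of $H$ that have a $G$-neighbour outside $H$. Put $$\varrho_r(G,e)=\mathbf E\sup_{A\subseteq\partial\mathbb B_e^r(G)}\bigl|\mathbf 1_{\{e\in\mathcal M_{\mathbb B_e^r(G)}\}}-\mathbf 1_{\{e\in\mathcal M_{\mathbb B_e^r(G)\setminus A}\}}\bigr| ,$$ where $\setminus A$ means deletion of the vertices in $A$. The graph $G$ satisfies *correlation decay* if $\varrho_r(G,e)\to0$ as $r\to\infty$ for every $e\in E(G)$. In this case $\mathcal M_G$ denotes the set of edges $e$ with $\lim_k\mathbf 1_{\{e\in\mathcal M_{H_k}\}}=1$ for the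 sequences $(H_k)$ of finite subgraphs increasing to $G$ (almost surely the limit exists and does not depend on the sequence; for finite $G$ this is the maximum weight matching of $G$). Let $\mathcal G^*$ be the space of isomorphism classes of locally finite connected rooted graphs with the metric $d_{\rm loc}=1/(R+1)$, where $R$ is the supremum of all real $r\ge0$ such that the balls of radius $r$ around the two roots are isomorphic as rooted graphs. Let $\mathcal G^*_{\mathbb R^k}$ be the space of isomorphism classes of such graphs with marks in $\mathbb R^k$ on the edges, with the metric $1/(R+1)$, where $R$ is now the supremum of all real $r\ge0$ such that there is a rooted isomorphism $\phi$ between the balls of radius $r$ with $\bigl(\sum_e\|m^1_e-m^2_{\phi(e)}\|_2^2\bigr)^{1/2}\le2^{-r}$, the sum being over the edges of the first ball. *Local weak convergence* is convergence of $\mathbf E\,h$ for every bounded continuous $h$ on the respective space. A finite graph with root $o$ is regarded as an element of these spaces through the connected component of $o$. **Proposition.** Let $(G_n)$ be a sequence of random finite nonempty graphs and, given $G_n$, let $o_n$ be a uniformly chosen vertex of $G_n$. Suppose that $(G_n,o_n)$ converges locally weakly to a random rooted graph $(G,o)$ in $\mathcal G^*$, and that almost surely under the law of $(G,o)$ the graph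 $G$ satisfies correlation decay. Given the rooted graphs, let the edges of $G_n$ and of $G$ carry i.i.d. weights $w_e$ with law $\nu$. Then $\bigl(G_n,o_n,(w_e)_{e\in E(G_n)},(\mathbf 1_{\{e\in\mathcal M_{G_n}\}})_{e\in E(G_n)}\bigr)$ and $\bigl(G,o,(w_e)_{e\in E(G)},(\mathbf 1_{\{e\in\mathcal M_G\}})_{e\in E(G)}\bigr)$ are well-defined random elements of $\mathcal G^*_{\mathbb R^2}$, and the former converge locally weakly to the latter as $n\to\infty$. -/

import Mathlib

open MeasureTheory Filter Topology
open scoped NNReal ENNReal BoundedContinuousFunction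

noncomputable section

namespace LocalMWM

/-! ### Matchings and maximum weight matchings -/

section Matching

variable {V : Type} {G : SimpleGraph V}

/-- A finite set of edges of `G` is a matching of the subgraph `H` if all its edges belong to `H`
and no two distinct ones share an endpoint. -/
def IsMatchingOf (H : G.Subgraph) (M : Finset G.edgeSet) : Prop :=
  (∀ e ∈ M, (e : Sym2 V) ∈ H.edgeSet) ∧
    ∀ e ∈ M, ∀ f ∈ M, e ≠ f → ¬ ∃ v : V, v ∈ (e : Sym2 V) ∧ v ∈ (f : Sym2 V)

/-- `M` is a matching of `H` of maximum total weight. -/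
def IsMaxWeightMatching (H : G.Subgraph) (w : G.edgeSet → ℝ) (M : Finset G.edgeSet) : Prop :=
  IsMatchingOf H M ∧ ∀ M', IsMatchingOf H M' → ∑ e ∈ M', w e ≤ ∑ e ∈ M, w e

/-- The edge set of the maximum weight matching of a finite subgraph `H`. With i.i.d. weights from
an atomless law the maximizer is almost surely unique; on the null event where it is not, the
value is the empty set. -/
def mwm (H : G.Subgraph) (w : G.edgeSet → ℝ) : Set G.edgeSet :=
  {e | ∃ M, (∀ M', IsMaxWeightMatching H w M' ↔ M' = M) ∧ e ∈ M}

/-- A sequence of finite subgraphs that increases to `G`. -/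
def IsExhaustion (H : ℕ → G.Subgraph) : Prop :=
  Monotone H ∧ (∀ n, (H n).verts.Finite) ∧ ⨆ n, H n = ⊤

variable (G) in
/-- The maximum weight matching of a (finite or infinite) locally finite connected graph: the set
of all edges `e` such that the indicator of `e ∈ mwm (H n)` tends to `1` for the
sequences `H` of finite subgraphs increasing to `G`. Under correlation decay, almost surely this
limit exists for all such sequences and does not depend on the sequence; and for a finite graph
this is the maximum weight matching of the graph, since then `H n = ⊤` eventually. -/
def limitMwm (w : G.edgeSet → ℝ) : Set G.edgeSet :=
  {e | ∀ H : ℕ → G.Subgraph, IsExhaustion H →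
    Tendsto (fun n => (mwm (H n) w).indicator (fun _ => (1 : ℝ)) e) atTop (𝓝 1)}

/-! ### Correlation decay -/

variable (G) in
/-- The subgraph induced by all vertices at graph distance at most `r` from an endpoint of `e`. -/
def edgeBall (e : G.edgeSet) (r : ℕ) : G.Subgraph :=
  (⊤ : G.Subgraph).induce {x | ∃ v ∈ (e : Sym2 V), G.edist v x ≤ r}

/-- The vertices of `H` that have a `G`-neighbour outside `H`. -/
def vertexBoundary (H : G.Subgraph) : Set V :=
  {v | v ∈ H.verts ∧ ∃ u, u ∉ H.verts ∧ G.Adj v u}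

variable (G) in
/-- The law of i.i.d. edge weights with common law `ν`. -/
def weightLaw (ν : Measure ℝ) : Measure (G.edgeSet → ℝ) :=
  Measure.infinitePi fun _ : G.edgeSet => ν

variable (G) in
/-- `ϱ_r(G, e) = E sup_A |1{e ∈ M(B)} - 1{e ∈ M(B \ A)}|`, where `B` is the ball of radius `r`
around `e`, and `A` ranges over all sets of boundary vertices of `B`. -/
def corrDefect (ν : Measure ℝ) (r : ℕ) (e : G.edgeSet) : ℝ :=
  ∫ w, ⨆ A : {A : Set V // A ⊆ vertexBoundary (edgeBall G e r)},
    |(mwm (edgeBall G e r) w).indicator (fun _ => (1 : ℝ)) e -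
      (mwm ((edgeBall G e r).deleteVerts A.1) w).indicator (fun _ => (1 : ℝ)) e| ∂(weightLaw G ν)

variable (G) in
/-- The correlation decay property of a locally finite connected graph, for i.i.d. edge weights
with law `ν`. -/
def CorrelationDecay (ν : Measure ℝ) : Prop :=
  ∀ e : G.edgeSet, Tendsto (fun r : ℕ => corrDefect G ν r e) atTop (𝓝 0)

end Matching

/-! ### Rooted graphs, marked rooted graphs, and the local metrics -/

/-- A locally finite connected rooted graph. (Every such graph is countable, so that vertex types
in `Type` are enough.) With the pseudometric `d_loc` below, rooted graphs are at distance `0` if and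
only if they are isomorphic, so Borel sets, Borel measures and continuous functions on this type are
the same as those on the metric space of isomorphism classes. -/
structure RootedGraph : Type 1 where
  V : Type
  graph : SimpleGraph V
  root : V
  locallyFinite : ∀ v, (graph.neighborSet v).Finite
  connected : graph.Connected

/-- A locally finite connected rooted graph with marks in `ℝ^k` (with the Euclidean norm) on its
edges. The remark on isomorphism classes applies here too. -/
structure MarkedGraph (k : ℕ) : Type 1 extends RootedGraph where
  mark : graph.edgeSet → EuclideanSpace ℝ (Fin k)

/-- The vertices at distance at most `r` from the root. -/
def RootedGraph.ball (g : RootedGraph) (r : ℝ≥0) : Set g.V :=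
  {v | (g.graph.dist g.root v : ℝ) ≤ r}

/-- The subgraph induced by the ball of radius `r` around the root. -/
abbrev RootedGraph.ballGraph (g : RootedGraph) (r : ℝ≥0) : SimpleGraph (g.ball r) :=
  g.graph.induce (g.ball r)

/-- The mark of an edge of the ball of radius `r` around the root. -/
def MarkedGraph.ballMark {k : ℕ} (g : MarkedGraph k) (r : ℝ≥0) (e : (g.ballGraph r).edgeSet) :
    EuclideanSpace ℝ (Fin k) :=
  g.mark ((SimpleGraph.Embedding.induce (g.ball r)).mapEdgeSet e)

/-- The isomorphism `φ` of balls maps root to root. -/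
def PreservesRoot {g h : RootedGraph} {r : ℝ≥0} (φ : g.ballGraph r ≃g h.ballGraph r) : Prop :=
  ∀ v : g.ball r, (v : g.V) = g.root → (φ v : h.V) = h.root

/-- The Euclidean distance between the marks on two isomorphic balls (a finite sum). -/
def markCost {k : ℕ} {g h : MarkedGraph k} {r : ℝ≥0} (φ : g.ballGraph r ≃g h.ballGraph r) : ℝ :=
  √(∑ᶠ e, ‖g.ballMark r e - h.ballMark r (φ.mapEdgeSet e)‖ ^ 2)

/-- The balls of radius `r` around the roots are isomorphic as rooted graphs. -/
def BallsIso (g h : RootedGraph) (r : ℝ≥0) : Prop :=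
  ∃ φ : g.ballGraph r ≃g h.ballGraph r, PreservesRoot φ

/-- The balls of radius `r` around the roots are isomorphic as rooted graphs, with marks that differ
by at most `2 ^ (-r)`. -/
def MarkedBallsClose {k : ℕ} (g h : MarkedGraph k) (r : ℝ≥0) : Prop :=
  ∃ φ : g.ballGraph r ≃g h.ballGraph r, PreservesRoot φ ∧ markCost φ ≤ (2 : ℝ) ^ (-(r : ℝ))

/-- The number `1 / (R + 1)`, where `R = sup {r ≥ 0 : P r} ∈ [0, ∞]` (and `1 / (∞ + 1) = 0`). -/
def localDist (P : ℝ≥0 → Prop) : ℝ :=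
  (1 / ((⨆ r : {r : ℝ≥0 // P r}, (r : ℝ≥0∞)) + 1)).toReal

instance : Dist RootedGraph := ⟨fun g h => localDist (BallsIso g h)⟩

instance {k : ℕ} : Dist (MarkedGraph k) := ⟨fun g h => localDist (MarkedBallsClose g h)⟩

/-! #### The local metrics are pseudometrics -/

lemma RootedGraph.mem_ball {g : RootedGraph} {r : ℝ≥0} {v : g.V} :
    v ∈ g.ball r ↔ (g.graph.dist g.root v : ℝ) ≤ r := Iff.rfl

lemma RootedGraph.ball_finite (g : RootedGraph) (r : ℝ≥0) : (g.ball r).Finite := by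
  have key : ∀ n : ℕ, {v | g.graph.dist g.root v ≤ n}.Finite := by
    intro n
    induction n with
    | zero =>
      refine (Set.finite_singleton g.root).subset fun v hv => ?_
      have h0 : g.graph.dist g.root v = 0 := Nat.le_zero.1 hv
      exact (g.connected.dist_eq_zero_iff.1 h0).symm
    | succ n ih =>
      refine (ih.union (ih.biUnion fun u _ => g.locallyFinite u)).subset fun v hv => ?_
      rcases Nat.lt_or_ge n (g.graph.dist g.root v) with h | h
      · have h1 : g.graph.dist g.root v = n + 1 := le_antisymm hv h
        obtain ⟨p, hp⟩ := g.connected.exists_walk_length_eq_dist v g.root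
        rw [SimpleGraph.dist_comm, h1] at hp
        cases p with
        | nil => simp at hp
        | @cons _ u _ hadj q =>
          refine Or.inr (Set.mem_biUnion (x := u) ?_ hadj.symm)
          have := SimpleGraph.dist_le q
          rw [SimpleGraph.Walk.length_cons] at hp
          rw [SimpleGraph.dist_comm] at this
          exact this.trans (by omega)
      · exact Or.inl h
  refine (key ⌊r⌋₊).subset fun v hv => Nat.le_floor ?_
  exact_mod_cast hv

instance (g : RootedGraph) (r : ℝ≥0) : Finite (g.ball r) := g.ball_finite r

lemma RootedGraph.root_mem_ball (g : RootedGraph) (r : ℝ≥0) : g.root ∈ g.ball r := by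
  simp [RootedGraph.ball]

lemma RootedGraph.ball_mono (g : RootedGraph) {r s : ℝ≥0} (hrs : r ≤ s) : g.ball r ⊆ g.ball s :=
  fun _ hv => mem_ball.2 ((mem_ball.1 hv).trans (by exact_mod_cast hrs))

lemma dist_le_of_preservesRoot {g h : RootedGraph} {s : ℝ≥0}
    (φ : g.ballGraph s ≃g h.ballGraph s) (hφ : PreservesRoot φ) (v : g.ball s) :
    h.graph.dist h.root (φ v) ≤ g.graph.dist g.root v := by
  obtain ⟨n, hn⟩ : ∃ n, g.graph.dist g.root v = n := ⟨_, rfl⟩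
  rw [hn]
  induction n generalizing v with
  | zero => rw [hφ v (g.connected.dist_eq_zero_iff.1 hn).symm]; simp
  | succ n ih =>
    obtain ⟨p, hp⟩ := g.connected.exists_walk_length_eq_dist (v : g.V) g.root
    rw [SimpleGraph.dist_comm, hn] at hp
    obtain ⟨v, hv⟩ := v
    cases p with
    | nil => simp at hp
    | @cons _ u _ hadj q =>
      have h1 : g.graph.dist g.root u ≤ n := by
        have := SimpleGraph.dist_le q
        rw [SimpleGraph.Walk.length_cons] at hp
        rw [SimpleGraph.dist_comm] at this
        omega
      have h2 : g.graph.dist g.root v ≤ g.graph.dist g.root u + 1 := by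
        have := g.connected.dist_triangle (u := g.root) (v := u) (w := v)
        rwa [SimpleGraph.dist_eq_one_iff_adj.2 hadj.symm] at this
      have h3 : g.graph.dist g.root u = n := by simp only at hn; omega
      have hu : u ∈ g.ball s := by
        refine RootedGraph.mem_ball.2 (le_trans ?_ (RootedGraph.mem_ball.1 hv))
        simp only at hn
        rw [h3, hn]; push_cast; linarith
      have h4 := ih ⟨u, hu⟩ h3
      have h5 : h.graph.Adj (φ ⟨u, hu⟩) (φ ⟨v, hv⟩) :=
        φ.map_adj_iff.2 (show g.graph.Adj u v from hadj.symm)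
      have h6 := h.connected.dist_triangle (u := h.root) (v := (φ ⟨u, hu⟩ : h.V))
        (w := (φ ⟨v, hv⟩ : h.V))
      rw [SimpleGraph.dist_eq_one_iff_adj.2 h5] at h6
      omega

lemma PreservesRoot.symm {g h : RootedGraph} {s : ℝ≥0} {φ : g.ballGraph s ≃g h.ballGraph s}
    (hφ : PreservesRoot φ) : PreservesRoot φ.symm := by
  intro v hv
  have h1 := hφ ⟨g.root, g.root_mem_ball s⟩ rfl
  have h2 : v = φ ⟨g.root, g.root_mem_ball s⟩ := Subtype.ext (hv.trans h1.symm)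
  rw [h2]; simp

lemma PreservesRoot.trans {g h k : RootedGraph} {s : ℝ≥0} {φ : g.ballGraph s ≃g h.ballGraph s}
    {ψ : h.ballGraph s ≃g k.ballGraph s} (hφ : PreservesRoot φ) (hψ : PreservesRoot ψ) :
    PreservesRoot (φ.trans ψ) := fun v hv => hψ (φ v) (hφ v hv)

/-- The restriction of an isomorphism of rooted balls to smaller balls. -/
def restrictIso {g h : RootedGraph} {r s : ℝ≥0} (hrs : r ≤ s)
    (φ : g.ballGraph s ≃g h.ballGraph s) (hφ : PreservesRoot φ) :
    g.ballGraph r ≃g h.ballGraph r where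
  toFun v := ⟨φ ⟨v, g.ball_mono hrs v.2⟩,
    RootedGraph.mem_ball.2
    (le_trans (Nat.cast_le.2 (dist_le_of_preservesRoot φ hφ _)) (RootedGraph.mem_ball.1 v.2))⟩
  invFun v := ⟨φ.symm ⟨v, h.ball_mono hrs v.2⟩,
    RootedGraph.mem_ball.2
    (le_trans (Nat.cast_le.2 (dist_le_of_preservesRoot φ.symm hφ.symm _))
      (RootedGraph.mem_ball.1 v.2))⟩
  left_inv v := by simp
  right_inv v := by simp
  map_rel_iff' {u v} := φ.map_adj_iff (v := ⟨u, g.ball_mono hrs u.2⟩)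
    (w := ⟨v, g.ball_mono hrs v.2⟩)

lemma preservesRoot_restrictIso {g h : RootedGraph} {r s : ℝ≥0} (hrs : r ≤ s)
    (φ : g.ballGraph s ≃g h.ballGraph s) (hφ : PreservesRoot φ) :
    PreservesRoot (restrictIso hrs φ hφ) := fun v hv => hφ ⟨v, g.ball_mono hrs v.2⟩ hv

lemma markCost_symm {k : ℕ} {g h : MarkedGraph k} {r : ℝ≥0}
    (φ : g.ballGraph r ≃g h.ballGraph r) : markCost φ.symm = markCost φ := by
  unfold markCost
  congr 1
  refine (finsum_eq_of_bijective φ.mapEdgeSet φ.mapEdgeSet.bijective fun e => ?_).symm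
  rw [norm_sub_rev]
  congr 3
  exact congrArg _ (φ.mapEdgeSet.symm_apply_apply e).symm

lemma markCost_trans {k : ℕ} {g h l : MarkedGraph k} {r : ℝ≥0}
    (φ : g.ballGraph r ≃g h.ballGraph r) (ψ : h.ballGraph r ≃g l.ballGraph r) :
    markCost (φ.trans ψ) ≤ markCost φ + markCost ψ := by
  classical
  have : Fintype (g.ballGraph r).edgeSet := Fintype.ofFinite _
  have h2 : markCost ψ = √(∑ᶠ e, ‖h.ballMark r (φ.mapEdgeSet e) -
      l.ballMark r (ψ.mapEdgeSet (φ.mapEdgeSet e))‖ ^ 2) := by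
    unfold markCost
    congr 1
    exact (finsum_eq_of_bijective φ.mapEdgeSet φ.mapEdgeSet.bijective fun e => rfl).symm
  have h3 : ∀ e, SimpleGraph.Iso.mapEdgeSet (φ.trans ψ) e = ψ.mapEdgeSet (φ.mapEdgeSet e) := by
    intro e
    apply Subtype.ext
    exact (Sym2.map_map (g := ψ) (f := φ) e.1).symm
  rw [h2]
  unfold markCost
  simp only [finsum_eq_sum_of_fintype]
  simp_rw [h3]
  have := norm_add_le
    (WithLp.toLp 2 fun e => g.ballMark r e - h.ballMark r (φ.mapEdgeSet e) :
      PiLp 2 fun _ : (g.ballGraph r).edgeSet => EuclideanSpace ℝ (Fin k))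
    (WithLp.toLp 2 fun e => h.ballMark r (φ.mapEdgeSet e) -
      l.ballMark r (ψ.mapEdgeSet (φ.mapEdgeSet e)))
  rw [PiLp.norm_eq_of_L2, PiLp.norm_eq_of_L2, PiLp.norm_eq_of_L2] at this
  simpa only [PiLp.add_apply, sub_add_sub_cancel] using this

lemma markCost_restrictIso {k : ℕ} {g h : MarkedGraph k} {r s : ℝ≥0} (hrs : r ≤ s)
    (φ : g.ballGraph s ≃g h.ballGraph s) (hφ : PreservesRoot φ) :
    markCost (restrictIso hrs φ hφ) ≤ markCost φ := by
  classical
  have : Fintype (g.ballGraph r).edgeSet := Fintype.ofFinite _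
  have : Fintype (g.ballGraph s).edgeSet := Fintype.ofFinite _
  unfold markCost
  apply Real.sqrt_le_sqrt
  simp only [finsum_eq_sum_of_fintype]
  let i : (g.ballGraph r).edgeSet ↪ (g.ballGraph s).edgeSet :=
    (SimpleGraph.induceHomOfLE g.graph (g.ball_mono hrs)).mapEdgeSet
  have h1 : ∀ e, ‖g.ballMark r e - h.ballMark r ((restrictIso hrs φ hφ).mapEdgeSet e)‖ ^ 2 =
      ‖g.ballMark s (i e) - h.ballMark s (φ.mapEdgeSet (i e))‖ ^ 2 := by
    rintro ⟨e, he⟩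
    induction e with
    | _ a b => rfl
  simp only [h1]
  rw [← Finset.sum_map Finset.univ i
    (fun e => ‖g.ballMark s e - h.ballMark s (φ.mapEdgeSet e)‖ ^ 2)]
  exact Finset.sum_le_sum_of_subset_of_nonneg (Finset.subset_univ _) fun _ _ _ => by positivity

lemma exists_iso_of_lt_one (g h : RootedGraph) {r : ℝ≥0} (hr : r < 1) :
    ∃ φ : g.ballGraph r ≃g h.ballGraph r, PreservesRoot φ := by
  have key : ∀ (g : RootedGraph) (v : g.ball r), (v : g.V) = g.root := by
    intro g v
    have h1 : (g.graph.dist g.root v : ℝ) < 1 := lt_of_le_of_lt v.2 (by exact_mod_cast hr)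
    have h2 : g.graph.dist g.root v = 0 := by exact_mod_cast Nat.lt_one_iff.1 (by exact_mod_cast h1)
    exact (g.connected.dist_eq_zero_iff.1 h2).symm
  refine ⟨⟨⟨fun _ => ⟨h.root, h.root_mem_ball r⟩, fun _ => ⟨g.root, g.root_mem_ball r⟩, ?_, ?_⟩, ?_⟩,
    fun v hv => rfl⟩
  · intro v; exact Subtype.ext (key g v).symm
  · intro v; exact Subtype.ext (key h v).symm
  · intro a b
    simp [key g a, key g b]

lemma ballsIso_of_lt_one (g h : RootedGraph) {r : ℝ≥0} (hr : r < 1) : BallsIso g h r :=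
  exists_iso_of_lt_one g h hr

lemma markedBallsClose_of_lt_one {k : ℕ} (g h : MarkedGraph k) {r : ℝ≥0} (hr : r < 1) :
    MarkedBallsClose g h r := by
  obtain ⟨φ, hφ⟩ := exists_iso_of_lt_one g.toRootedGraph h.toRootedGraph hr
  refine ⟨φ, hφ, ?_⟩
  have : IsEmpty (g.ballGraph r).edgeSet := by
    have key : ∀ v : g.ball r, (v : g.V) = g.root := by
      intro v
      have h1 : (g.graph.dist g.root v : ℝ) < 1 := lt_of_le_of_lt v.2 (by exact_mod_cast hr)
      have h2 : g.graph.dist g.root v = 0 := Nat.lt_one_iff.1 (by exact_mod_cast h1)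
      exact (g.connected.dist_eq_zero_iff.1 h2).symm
    refine ⟨fun e => ?_⟩
    obtain ⟨e, he⟩ := e
    induction e with
    | _ a b =>
      have : g.graph.Adj a b := he
      rw [key a, key b] at this
      exact g.graph.loopless.irrefl _ this
  unfold markCost
  rw [finsum_of_isEmpty, Real.sqrt_zero]
  positivity

lemma rpow_aux {t : ℝ} (ht : 0 ≤ t) : 1 + (2 : ℝ) ^ (-t) ≤ 2 ^ (4 / (4 + t)) := by
  have hl1 := Real.log_two_gt_d9
  have hl2 := Real.log_two_lt_d9
  set c := Real.log 2
  have hexp : ∀ x : ℝ, (2 : ℝ) ^ x = Real.exp (c * x) := fun x =>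
    Real.rpow_def_of_pos (by norm_num) x
  have h1 : (2 : ℝ) ^ (-t) ≤ 1 / (1 + c * t) := by
    rw [Real.rpow_neg (by norm_num), one_div, hexp]
    apply inv_anti₀ (by positivity)
    linarith [Real.add_one_le_exp (c * t)]
  have hpos : 0 < 1 + c * t := by positivity
  rcases le_total t 3 with h3 | h3
  · have h2 : 2 * (1 + c * (4 / (4 + t) - 1)) ≤ (2 : ℝ) ^ (4 / (4 + t)) := by
      have : (2 : ℝ) ^ (4 / (4 + t)) = 2 * 2 ^ (4 / (4 + t) - 1) := by
        rw [Real.rpow_sub_one (by norm_num)]; ring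
      rw [this, hexp]
      linarith [Real.add_one_le_exp (c * (4 / (4 + t) - 1))]
    refine le_trans ?_ h2
    have e1 : 4 / (4 + t) - 1 = - (t / (4 + t)) := by field_simp; ring
    have e2 : 2 * (c * (t / (4 + t))) ≤ 1 - 1 / (1 + c * t) := by
      have : 1 - 1 / (1 + c * t) = c * t / (1 + c * t) := by field_simp; ring
      rw [this]
      have h4 : 2 * (c * (t / (4 + t))) = 2 * (c * t) / (4 + t) := by ring
      rw [h4, div_le_div_iff₀ (by positivity) hpos]
      have h5 : 0 ≤ c * t := by positivity
      have h6 : 2 * (1 + c * t) ≤ 4 + t := by nlinarith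
      nlinarith [mul_le_mul_of_nonneg_left h6 h5]
    rw [e1]
    linarith
  · have h2 : 1 + c * (4 / (4 + t)) ≤ (2 : ℝ) ^ (4 / (4 + t)) := by
      rw [hexp]
      linarith [Real.add_one_le_exp (c * (4 / (4 + t)))]
    refine le_trans ?_ h2
    have : 1 / (1 + c * t) ≤ c * (4 / (4 + t)) := by
      have h4 : c * (4 / (4 + t)) = 4 * c / (4 + t) := by ring
      rw [h4, div_le_div_iff₀ hpos (by positivity)]
      nlinarith [mul_nonneg (sub_nonneg.2 hl1.le) (sub_nonneg.2 hl1.le)]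
    linarith

lemma exists_radius_of_le {s t : ℝ} (hs : 1 ≤ s) (hst : s ≤ t) :
    ∃ r : ℝ, 0 ≤ r ∧ r ≤ s ∧ r ≤ t ∧ (2 : ℝ) ^ (-s) + (2 : ℝ) ^ (-t) ≤ 2 ^ (-r) ∧
      1 / (r + 1) ≤ 1 / (s + 1) + 1 / (t + 1) := by
  have hpos : 0 < s + t + 2 := by linarith
  have hr : (s + 1) * (t + 1) / (s + t + 2) - 1 = s - (s + 1) ^ 2 / (s + t + 2) := by
    field_simp; ring
  have hle : (s + 1) * (t + 1) / (s + t + 2) - 1 ≤ s := by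
    rw [hr]; have : 0 ≤ (s + 1) ^ 2 / (s + t + 2) := by positivity
    linarith
  refine ⟨(s + 1) * (t + 1) / (s + t + 2) - 1, ?_, hle, hle.trans hst, ?_, ?_⟩
  · rw [sub_nonneg, le_div_iff₀ hpos]; nlinarith
  · have h1 := rpow_aux (sub_nonneg.2 hst)
    have h2 : 4 / (4 + (t - s)) ≤ (s + 1) ^ 2 / (s + t + 2) := by
      rw [div_le_div_iff₀ (by linarith) hpos]
      nlinarith [mul_nonneg (sub_nonneg.2 hst) (by nlinarith : (0 : ℝ) ≤ (s + 1) ^ 2 - 4)]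
    have h3 : 1 + (2 : ℝ) ^ (-(t - s)) ≤ 2 ^ ((s + 1) ^ 2 / (s + t + 2)) :=
      h1.trans (Real.rpow_le_rpow_of_exponent_le (by norm_num) h2)
    have h4 := mul_le_mul_of_nonneg_left h3 (Real.rpow_nonneg (by norm_num : (0 : ℝ) ≤ 2) (-s))
    rw [mul_add, mul_one, ← Real.rpow_add (by norm_num), ← Real.rpow_add (by norm_num)] at h4
    rw [hr]
    rwa [show -s + -(t - s) = -t by ring, show -s + (s + 1) ^ 2 / (s + t + 2) =
      -(s - (s + 1) ^ 2 / (s + t + 2)) by ring] at h4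
  · rw [sub_add_cancel]
    have : 0 < s + 1 := by linarith
    have : 0 < t + 1 := by linarith
    apply le_of_eq
    field_simp
    ring

lemma exists_radius {s t : ℝ} (hs : 1 ≤ s) (ht : 1 ≤ t) :
    ∃ r : ℝ, 0 ≤ r ∧ r ≤ s ∧ r ≤ t ∧ (2 : ℝ) ^ (-s) + (2 : ℝ) ^ (-t) ≤ 2 ^ (-r) ∧
      1 / (r + 1) ≤ 1 / (s + 1) + 1 / (t + 1) := by
  rcases le_total s t with h | h
  · exact exists_radius_of_le hs h
  · obtain ⟨r, h0, h1, h2, h3, h4⟩ := exists_radius_of_le ht h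
    exact ⟨r, h0, h2, h1, by linarith, by linarith⟩

lemma localDist_le {P : ℝ≥0 → Prop} {r : ℝ≥0} (hr : P r) : localDist P ≤ 1 / (r + 1) := by
  have h1 : (r : ℝ≥0∞) ≤ ⨆ r : {r : ℝ≥0 // P r}, (r : ℝ≥0∞) :=
    le_iSup (fun r : {r : ℝ≥0 // P r} => (r : ℝ≥0∞)) ⟨r, hr⟩
  have h2 : (1 / ((⨆ r : {r : ℝ≥0 // P r}, (r : ℝ≥0∞)) + 1)) ≤ 1 / ((r : ℝ≥0∞) + 1) :=
    ENNReal.div_le_div_left (by gcongr) 1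
  have h3 := ENNReal.toReal_mono (by simp) h2
  refine h3.trans (le_of_eq ?_)
  rw [ENNReal.toReal_div, ENNReal.toReal_add (by simp) (by simp)]
  simp

lemma le_localDist {P : ℝ≥0 → Prop} {x : ℝ} (h0 : P 0)
    (hx : ∀ r, P r → x ≤ 1 / (r + 1)) : x ≤ localDist P := by
  have : Nonempty {r : ℝ≥0 // P r} := ⟨⟨0, h0⟩⟩
  unfold localDist
  rw [one_div, ENNReal.iSup_add, ENNReal.inv_iSup,
    ← ENNReal.ofReal_le_iff_le_toReal]
  · refine le_iInf fun r => ?_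
    have h := ENNReal.ofReal_le_ofReal (hx r.1 r.2)
    refine h.trans (le_of_eq ?_)
    rw [one_div, ENNReal.ofReal_inv_of_pos (by positivity), ENNReal.ofReal_add (by simp) (by simp)]
    simp
  · refine ne_top_of_le_ne_top ?_ (iInf_le _ ⟨0, h0⟩)
    simp

lemma localDist_eq_zero {P : ℝ≥0 → Prop} (hP : ∀ r, P r) : localDist P = 0 := by
  refine le_antisymm (le_of_forall_pos_le_add fun ε hε => ?_) ENNReal.toReal_nonneg
  refine (localDist_le (hP (Real.toNNReal (1 / ε)))).trans ?_
  rw [Real.coe_toNNReal _ (by positivity), zero_add, div_le_iff₀ (by positivity)]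
  rw [mul_add, mul_one_div_cancel hε.ne']
  linarith

lemma localDist_triangle {P Q S : ℝ≥0 → Prop} (hP : ∀ r < 1, P r) (hQ : ∀ r < 1, Q r)
    (hS : ∀ r < 1, S r)
    (h : ∀ r s t : ℝ≥0, P s → Q t → r ≤ s → r ≤ t →
      (2 : ℝ) ^ (-(s : ℝ)) + (2 : ℝ) ^ (-(t : ℝ)) ≤ 2 ^ (-(r : ℝ)) → S r) :
    localDist S ≤ localDist P + localDist Q := by
  have hhalf : localDist S ≤ 1 / 2 := by
    refine le_of_forall_pos_le_add fun ε hε => ?_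
    by_cases h1 : ε < 1
    · have := localDist_le (hS (Real.toNNReal (1 - ε))
        (by rw [← Real.toNNReal_one]; exact (Real.toNNReal_lt_toNNReal_iff (by norm_num)).2
              (by linarith)))
      refine this.trans ?_
      rw [Real.coe_toNNReal _ (by linarith), div_le_iff₀ (by linarith)]
      nlinarith
    · refine (localDist_le (hS 0 (by norm_num))).trans ?_
      norm_num; linarith
  rw [← sub_le_iff_le_add]
  refine le_localDist (hP 0 (by norm_num)) fun s hs => ?_
  rw [sub_le_comm]
  refine le_localDist (hQ 0 (by norm_num)) fun t ht => ?_
  rw [sub_le_iff_le_add']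
  have ps : (0 : ℝ) ≤ 1 / (s + 1) := by positivity
  have pt : (0 : ℝ) ≤ 1 / (t + 1) := by positivity
  rcases lt_or_ge (s : ℝ) 1 with hs1 | hs1
  · have : 1 / 2 ≤ 1 / ((s : ℝ) + 1) := by
      apply one_div_le_one_div_of_le (by positivity); linarith
    linarith
  rcases lt_or_ge (t : ℝ) 1 with ht1 | ht1
  · have : 1 / 2 ≤ 1 / ((t : ℝ) + 1) := by
      apply one_div_le_one_div_of_le (by positivity); linarith
    linarith
  obtain ⟨r, h0, h1, h2, h3, h4⟩ := exists_radius hs1 ht1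
  exact (localDist_le (h ⟨r, h0⟩ s t hs ht h1 h2 h3)).trans h4

lemma BallsIso.symm {g h : RootedGraph} {r : ℝ≥0} : BallsIso g h r → BallsIso h g r :=
  fun ⟨φ, hφ⟩ => ⟨φ.symm, hφ.symm⟩

lemma MarkedBallsClose.symm {k : ℕ} {g h : MarkedGraph k} {r : ℝ≥0} :
    MarkedBallsClose g h r → MarkedBallsClose h g r :=
  fun ⟨φ, hφ, hc⟩ => ⟨φ.symm, hφ.symm, (markCost_symm φ).trans_le hc⟩

instance : PseudoMetricSpace RootedGraph where
  dist_self g := localDist_eq_zero fun r => ⟨RelIso.refl _, fun _ hv => hv⟩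
  dist_comm g h := congrArg localDist (funext fun r => propext ⟨BallsIso.symm, BallsIso.symm⟩)
  dist_triangle g h l := by
    refine localDist_triangle (fun r hr => ballsIso_of_lt_one g h hr)
      (fun r hr => ballsIso_of_lt_one h l hr) (fun r hr => ballsIso_of_lt_one g l hr) ?_
    rintro r s t ⟨φ, hφ⟩ ⟨ψ, hψ⟩ hrs hrt -
    exact ⟨(restrictIso hrs φ hφ).trans (restrictIso hrt ψ hψ),
      (preservesRoot_restrictIso hrs φ hφ).trans (preservesRoot_restrictIso hrt ψ hψ)⟩

instance {k : ℕ} : PseudoMetricSpace (MarkedGraph k) where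
  dist_self g := localDist_eq_zero fun r => by
    refine ⟨RelIso.refl _, fun _ hv => hv, ?_⟩
    have h0 : ∀ e, ‖g.ballMark r e - g.ballMark r
        (SimpleGraph.Iso.mapEdgeSet (RelIso.refl _) e)‖ ^ 2 = 0 := by
      rintro ⟨e, he⟩
      induction e with
      | _ a b =>
        rw [sq_eq_zero_iff, norm_eq_zero, sub_eq_zero]
        rfl
    unfold markCost
    simp only [h0, finsum_zero, Real.sqrt_zero]
    positivity
  dist_comm g h :=
    congrArg localDist (funext fun r => propext ⟨MarkedBallsClose.symm, MarkedBallsClose.symm⟩)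
  dist_triangle g h l := by
    refine localDist_triangle (fun r hr => markedBallsClose_of_lt_one g h hr)
      (fun r hr => markedBallsClose_of_lt_one h l hr)
      (fun r hr => markedBallsClose_of_lt_one g l hr) ?_
    rintro r s t ⟨φ, hφ, hφc⟩ ⟨ψ, hψ, hψc⟩ hrs hrt hle
    refine ⟨(restrictIso hrs φ hφ).trans (restrictIso hrt ψ hψ),
      (preservesRoot_restrictIso hrs φ hφ).trans (preservesRoot_restrictIso hrt ψ hψ), ?_⟩
    calc markCost ((restrictIso hrs φ hφ).trans (restrictIso hrt ψ hψ))
        ≤ markCost (restrictIso hrs φ hφ) + markCost (restrictIso hrt ψ hψ) := markCost_trans _ _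
      _ ≤ markCost φ + markCost ψ :=
          add_le_add (markCost_restrictIso hrs φ hφ) (markCost_restrictIso hrt ψ hψ)
      _ ≤ (2 : ℝ) ^ (-(s : ℝ)) + (2 : ℝ) ^ (-(t : ℝ)) := add_le_add hφc hψc
      _ ≤ 2 ^ (-(r : ℝ)) := hle

instance : MeasurableSpace RootedGraph := borel _

instance : BorelSpace RootedGraph := ⟨rfl⟩

instance {k : ℕ} : MeasurableSpace (MarkedGraph k) := borel _

instance {k : ℕ} : BorelSpace (MarkedGraph k) := ⟨rfl⟩

/-- Local weak convergence: weak convergence for the local topology. -/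
def LocallyWeaklyConverges {X : Type*} [TopologicalSpace X] [MeasurableSpace X]
    (μs : ℕ → Measure X) (μ : Measure X) : Prop :=
  ∀ h : X →ᵇ ℝ, Tendsto (fun n => ∫ x, h x ∂(μs n)) atTop (𝓝 (∫ x, h x ∂μ))

/-! ### Random graphs, random roots, random weights -/

/-- Finite nonempty graphs, labelled by `0, …, k`. They need not be connected. A random finite
graph is given by its law, a probability measure on this countable discrete space. -/
def FiniteGraph : Type := Σ k : ℕ, SimpleGraph (Fin (k + 1))

instance : MeasurableSpace FiniteGraph := ⊤

/-- The uniform distribution on the vertices of a finite graph. -/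
def uniformVertex (G : FiniteGraph) : Measure (Fin (G.1 + 1)) :=
  ProbabilityTheory.uniformOn Set.univ

/-- The finite graph `G` rooted at `v`, as a connected rooted graph: the connected component
of `v` in `G` (which is `G` itself if `G` is connected), rooted at `v`. -/
def RootedGraph.ofComponent {V : Type} [Finite V] (G : SimpleGraph V) (v : V) : RootedGraph where
  V := G.connectedComponentMk v
  graph := (G.connectedComponentMk v).toSimpleGraph
  root := ⟨v, rfl⟩
  locallyFinite _ := Set.toFinite _
  connected := (G.connectedComponentMk v).connected_toSimpleGraph

/-- The finite graph `G` with edge marks `m`, rooted at `v`: the connected component of `v`, with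
the marks of its edges. -/
def MarkedGraph.ofComponent {k : ℕ} {V : Type} [Finite V] (G : SimpleGraph V) (v : V)
    (m : G.edgeSet → EuclideanSpace ℝ (Fin k)) : MarkedGraph k where
  toRootedGraph := RootedGraph.ofComponent G v
  mark e := m ((G.connectedComponentMk v).toSimpleGraph_hom.mapEdgeSet e)

/-- The edge marks `(w_e, 1{e ∈ M})`. -/
def matchingMarks {V : Type} {G : SimpleGraph V} (w : G.edgeSet → ℝ) (M : Set G.edgeSet) :
    G.edgeSet → EuclideanSpace ℝ (Fin 2) :=
  fun e => !₂[w e, M.indicator (fun _ => (1 : ℝ)) e]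

/-- The law of `(G, o)`, where `G` is a random finite graph with law `γ` and, given `G`, the root `o`
is uniform on the vertices of `G`. -/
def rootedLaw (γ : Measure FiniteGraph) : Measure RootedGraph :=
  γ.bind fun G => (uniformVertex G).map fun o => RootedGraph.ofComponent G.2 o

/-- The law of `(G, o, (w_e), (1{e ∈ M_G}))`, where `G` is a random finite graph with law `γ` and,
given `G`, the root `o` is uniform on the vertices of `G`, the weights `w_e` are i.i.d. with law `ν`
and independent of `o`, and `M_G` is the maximum weight matching of `G`. -/
def finiteMatchingLaw (ν : Measure ℝ) (γ : Measure FiniteGraph) : Measure (MarkedGraph 2) :=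
  γ.bind fun G => ((uniformVertex G).prod (weightLaw G.2 ν)).map fun p =>
    MarkedGraph.ofComponent G.2 p.1 (matchingMarks p.2 (mwm ⊤ p.2))

/-- The law of `(G, o, (w_e), (1{e ∈ M_G}))`, where `(G, o)` is a random rooted graph with law `μ`
and, given `(G, o)`, the weights `w_e` are i.i.d. with law `ν`, and `M_G` is the maximum weight
matching of the possibly infinite graph `G`. -/
def limitMatchingLaw (ν : Measure ℝ) (μ : Measure RootedGraph) : Measure (MarkedGraph 2) :=
  μ.bind fun g => (weightLaw g.graph ν).map fun w =>
    { g with mark := matchingMarks w (limitMwm g.graph w) }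

end LocalMWM

end

/-! The proof replaces the matching by a local rule and controls the error by a continuous function
of the rooted graph.

Almost surely no two finite edge sets have the same weight (`ae_genericWeights`), so maximum weight
matchings are unique. Then there is a spatial Markov property (`GenericWeights.exists_boundary`):
inside an induced subgraph `B` of `H`, the matching of `H` is the matching of `B` with some boundary
vertices deleted, namely those matched out of `B`. Hence the status of `e` in any finite graph
containing its `r`-ball, or in the limit matching, differs from its status in the ball by at most
`boundaryEffect`, whose mean is `corrDefect`.

Let `localMwm` decide each edge by looking only at its own `r`-ball. For a test function that is
Lipschitz and has oscillation at most `C`, replacing the true matching by `localMwm` costs at most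
`L / (K + 1)` for everything outside the `K`-ball of the root, plus `C` times `ballDefect`, the
truncated sum of the defects over the edges of the `K`-ball (`abs_integral_matchingLaw_sub_le`).
Both the local law, tested on such a function, and `ballDefect` are continuous in the rooted graph:
the first by coupling the weights on isomorphic balls, the second because it is locally constant.

This continuity removes any need for uniform correlation decay along the sequence. Decay for the
limit graph makes the mean of `ballDefect` small at some radius `r`, and local weak convergence
transfers this smallness to all late `n`. An `ε / 5` argument concludes
(`tendsto_integral_limitMatchingLaw`).

A finite connected graph has correlation decay, since large balls have no boundary, and the matching
of a finite graph restricts to that of each component. So the finite laws are instances of the limit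
construction (`finiteMatchingLaw_eq_limitMatchingLaw`), and one convergence statement covers both
sides. -/

open MeasureTheory Filter Topology
open scoped NNReal ENNReal BoundedContinuousFunction

noncomputable section

namespace LocalMWM

/-! ### Uniqueness, the spatial Markov property, and the influence of the boundary -/

section Matching

variable {V : Type} {G : SimpleGraph V}

/-- Distinct finite sets of edges have distinct total weights. -/
def GenericWeights (w : G.edgeSet → ℝ) : Prop :=
  Function.Injective fun S : Finset G.edgeSet => ∑ e ∈ S, w e

lemma isMatchingOf_empty (H : G.Subgraph) : IsMatchingOf H ∅ := by simp [IsMatchingOf]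

lemma finite_isMatchingOf {H : G.Subgraph} (hH : H.edgeSet.Finite) :
    {M | IsMatchingOf H M}.Finite := by
  classical
  have h1 : {e : G.edgeSet | (e : Sym2 V) ∈ H.edgeSet}.Finite :=
    hH.preimage Subtype.val_injective.injOn
  refine (h1.toFinset.powerset.finite_toSet).subset fun M hM => ?_
  simp only [Finset.coe_powerset, Set.mem_preimage, Set.mem_powerset_iff, Set.Finite.coe_toFinset]
  exact fun e he => hM.1 e he

lemma exists_isMaxWeightMatching {H : G.Subgraph} (hH : H.edgeSet.Finite) (w : G.edgeSet → ℝ) :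
    ∃ M, IsMaxWeightMatching H w M :=
  (Set.exists_max_image _ (fun M => ∑ e ∈ M, w e) (finite_isMatchingOf hH)
    ⟨∅, isMatchingOf_empty H⟩)

lemma GenericWeights.eq {w : G.edgeSet → ℝ} (hw : GenericWeights w) {H : G.Subgraph}
    {M M' : Finset G.edgeSet} (h : IsMaxWeightMatching H w M) (h' : IsMaxWeightMatching H w M') :
    M = M' :=
  hw (le_antisymm (h'.2 M h.1) (h.2 M' h'.1))

lemma GenericWeights.mem_mwm_iff {w : G.edgeSet → ℝ} (hw : GenericWeights w) {H : G.Subgraph}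
    {M : Finset G.edgeSet} (h : IsMaxWeightMatching H w M) {e : G.edgeSet} :
    e ∈ mwm H w ↔ e ∈ M := by
  constructor
  · rintro ⟨M', hM', he⟩
    rwa [(hM' M).1 h]
  · exact fun he => ⟨M, fun M' => ⟨fun h' => hw.eq h' h, fun h' => h' ▸ h⟩, he⟩

lemma mem_induce_top_edgeSet {S : Set V} {e : G.edgeSet} :
    (e : Sym2 V) ∈ ((⊤ : G.Subgraph).induce S).edgeSet ↔ ∀ v ∈ (e : Sym2 V), v ∈ S := by
  obtain ⟨e, he⟩ := e
  induction e with
  | _ a b =>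
    have : G.Adj a b := he
    simp [this]

/-- The maximum weight matching of a finite graph `H` restricts, on an induced subgraph `B` of `G`
contained in `H`, to the maximum weight matching of `B` with some boundary vertices removed. -/
lemma GenericWeights.exists_boundary {w : G.edgeSet → ℝ} (hw : GenericWeights w) {S : Set V}
    {H : G.Subgraph} (hH : H.edgeSet.Finite) (hSH : (⊤ : G.Subgraph).induce S ≤ H) :
    ∃ A ⊆ vertexBoundary ((⊤ : G.Subgraph).induce S),
      ∀ e : G.edgeSet, (e : Sym2 V) ∈ ((⊤ : G.Subgraph).induce S).edgeSet →
        (e ∈ mwm H w ↔ e ∈ mwm (((⊤ : G.Subgraph).induce S).deleteVerts A) w) := by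
  classical
  set B := (⊤ : G.Subgraph).induce S with hB
  obtain ⟨M, hM⟩ := exists_isMaxWeightMatching hH w
  -- The vertices of `S` that `M` matches to a vertex outside `S`.
  let A : Set V := {v | v ∈ S ∧ ∃ f ∈ M, v ∈ (f : Sym2 V) ∧ ∃ u ∈ (f : Sym2 V), u ∉ S}
  have hA : A ⊆ vertexBoundary B := by
    rintro v ⟨hv, ⟨f, hf⟩, -, hvf, u, huf, hu⟩
    have huv : v ≠ u := fun h => hu (h ▸ hv)
    have : f = s(v, u) := (Sym2.mem_and_mem_iff huv).1 ⟨hvf, huf⟩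
    subst this
    exact ⟨hv, u, hu, hf⟩
  have hdel : ∀ e : G.edgeSet, (e : Sym2 V) ∈ (B.deleteVerts A).edgeSet ↔
      (e : Sym2 V) ∈ B.edgeSet ∧ ∀ v ∈ (e : Sym2 V), v ∉ A := by
    rintro ⟨e, he⟩
    induction e with
    | _ a b =>
      have : G.Adj a b := he
      simp [hB, this]
      tauto
  let N : Finset G.edgeSet := M.filter fun e => (e : Sym2 V) ∈ B.edgeSet
  have hN : IsMaxWeightMatching (B.deleteVerts A) w N := by
    refine ⟨⟨fun e he => ?_, fun e he f hf => hM.1.2 e (Finset.mem_filter.1 he).1 f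
      (Finset.mem_filter.1 hf).1⟩, fun N' hN' => ?_⟩
    · obtain ⟨he1, he2⟩ := Finset.mem_filter.1 he
      refine (hdel e).2 ⟨he2, ?_⟩
      rintro v hv ⟨-, f, hf, hvf, u, huf, hu⟩
      by_cases hef : e = f
      · subst hef
        exact hu (mem_induce_top_edgeSet.1 he2 u huf)
      · exact hM.1.2 e he1 f hf hef ⟨v, hv, hvf⟩
    -- Exchange argument: a competitor `N'` avoids `A`, so it can be glued to the part `R` of `M`
    -- outside `B`. Maximality of `M` against `N' ∪ R`, with the weight of `R` cancelled, is
    -- maximality of `N`.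
    · let R : Finset G.edgeSet := M.filter fun e => (e : Sym2 V) ∉ B.edgeSet
      have hdisj : Disjoint N' R := by
        rw [Finset.disjoint_left]
        intro e he he'
        exact (Finset.mem_filter.1 he').2 ((hdel e).1 (hN'.1 e he)).1
      have hcross : ∀ e ∈ N', ∀ f ∈ R, ¬ ∃ v : V, v ∈ (e : Sym2 V) ∧ v ∈ (f : Sym2 V) := by
        rintro e he f hf ⟨v, hve, hvf⟩
        obtain ⟨he1, he2⟩ := (hdel e).1 (hN'.1 e he)
        obtain ⟨hf1, hf2⟩ := Finset.mem_filter.1 hf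
        rw [mem_induce_top_edgeSet] at hf2
        push Not at hf2
        exact he2 v hve ⟨mem_induce_top_edgeSet.1 he1 v hve, f, hf1, hvf, hf2⟩
      have hmatch : IsMatchingOf H (N' ∪ R) := by
        refine ⟨fun e he => ?_, fun e he f hf hef => ?_⟩
        · rcases Finset.mem_union.1 he with he | he
          · exact SimpleGraph.Subgraph.edgeSet_mono hSH ((hdel e).1 (hN'.1 e he)).1
          · exact hM.1.1 e (Finset.mem_filter.1 he).1
        · rcases Finset.mem_union.1 he with he | he <;> rcases Finset.mem_union.1 hf with hf | hf
          · exact hN'.2 e he f hf hef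
          · exact hcross e he f hf
          · rintro ⟨v, h1, h2⟩
            exact hcross f hf e he ⟨v, h2, h1⟩
          · exact hM.1.2 e (Finset.mem_filter.1 he).1 f (Finset.mem_filter.1 hf).1 hef
      have h1 := hM.2 _ hmatch
      rw [Finset.sum_union hdisj] at h1
      have h2 : ∑ e ∈ N, w e + ∑ e ∈ R, w e = ∑ e ∈ M, w e :=
        Finset.sum_filter_add_sum_filter_not M _ _
      linarith
  refine ⟨A, hA, fun e he => ?_⟩
  rw [hw.mem_mwm_iff hM, hw.mem_mwm_iff hN, Finset.mem_filter, and_iff_left he]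

/-- The event that `e` belongs to the maximum weight matching of `H`, as a real number. -/
abbrev mwmIndicator (H : G.Subgraph) (w : G.edgeSet → ℝ) (e : G.edgeSet) : ℝ :=
  (mwm H w).indicator (fun _ => (1 : ℝ)) e

variable (G) in
/-- The influence of the boundary of the ball of radius `r` around `e` on the status of `e`. -/
def boundaryEffect (r : ℕ) (e : G.edgeSet) (w : G.edgeSet → ℝ) : ℝ :=
  ⨆ A : {A : Set V // A ⊆ vertexBoundary (edgeBall G e r)},
    |mwmIndicator (edgeBall G e r) w e - mwmIndicator ((edgeBall G e r).deleteVerts A.1) w e|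

lemma abs_indicator_sub_le_one {α : Type*} (s t : Set α) (a : α) :
    |s.indicator (fun _ => (1 : ℝ)) a - t.indicator (fun _ => (1 : ℝ)) a| ≤ 1 := by
  by_cases h1 : a ∈ s <;> by_cases h2 : a ∈ t <;> simp [h1, h2]

lemma indicator_one_congr {α β : Type*} {s : Set α} {t : Set β} {a : α} {b : β}
    (h : a ∈ s ↔ b ∈ t) :
    s.indicator (fun _ => (1 : ℝ)) a = t.indicator (fun _ => (1 : ℝ)) b := by
  by_cases hb : b ∈ t
  · rw [Set.indicator_of_mem hb, Set.indicator_of_mem (h.2 hb)]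
  · rw [Set.indicator_of_notMem hb, Set.indicator_of_notMem (mt h.1 hb)]

lemma boundaryEffect_nonneg (r : ℕ) (e : G.edgeSet) (w : G.edgeSet → ℝ) :
    0 ≤ boundaryEffect G r e w :=
  Real.iSup_nonneg fun _ => abs_nonneg _

lemma corrDefect_nonneg (ν : Measure ℝ) (r : ℕ) (e : G.edgeSet) : 0 ≤ corrDefect G ν r e :=
  integral_nonneg fun w => boundaryEffect_nonneg r e w

lemma boundaryEffect_le_one (r : ℕ) (e : G.edgeSet) (w : G.edgeSet → ℝ) :
    boundaryEffect G r e w ≤ 1 :=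
  Real.iSup_le (fun _ => abs_indicator_sub_le_one _ _ _) zero_le_one

lemma le_boundaryEffect (r : ℕ) (e : G.edgeSet) (w : G.edgeSet → ℝ) {A : Set V}
    (hA : A ⊆ vertexBoundary (edgeBall G e r)) :
    |mwmIndicator (edgeBall G e r) w e - mwmIndicator ((edgeBall G e r).deleteVerts A) w e| ≤
      boundaryEffect G r e w :=
  le_ciSup (f := fun A : {A : Set V // A ⊆ vertexBoundary (edgeBall G e r)} =>
    |mwmIndicator (edgeBall G e r) w e - mwmIndicator ((edgeBall G e r).deleteVerts A.1) w e|)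
    ⟨1, by rintro _ ⟨A, rfl⟩; exact abs_indicator_sub_le_one _ _ _⟩ ⟨A, hA⟩

lemma mem_edgeBall_edgeSet (e : G.edgeSet) (r : ℕ) : (e : Sym2 V) ∈ (edgeBall G e r).edgeSet :=
  mem_induce_top_edgeSet.2 fun v hv => ⟨v, hv, by simp⟩

/-- By the Markov property the status of `e` in `H` is its status in the ball minus a boundary set,
which is one of the competitors in the supremum. -/
lemma GenericWeights.abs_sub_le_boundaryEffect {w : G.edgeSet → ℝ} (hw : GenericWeights w)
    {r : ℕ} {e : G.edgeSet} {H : G.Subgraph} (hH : H.edgeSet.Finite) (hle : edgeBall G e r ≤ H) :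
    |mwmIndicator (edgeBall G e r) w e - mwmIndicator H w e| ≤ boundaryEffect G r e w := by
  obtain ⟨A, hA, h⟩ := hw.exists_boundary hH hle
  refine le_trans (le_of_eq ?_) (le_boundaryEffect r e w hA)
  congr 2
  exact indicator_one_congr (h e (mem_edgeBall_edgeSet e r))

/-! ### Exhaustions -/

lemma finite_edgeSet_of_finite_verts {H : G.Subgraph} (h : H.verts.Finite) : H.edgeSet.Finite := by
  have : Finite H.verts := h
  have h2 : H.edgeSet ⊆ Sym2.map (Subtype.val : H.verts → V) '' Set.univ := by
    intro e he
    induction e with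
    | _ a b =>
      exact ⟨s(⟨a, H.edge_vert he⟩, ⟨b, H.edge_vert (H.adj_symm he)⟩), trivial, rfl⟩
  exact ((Set.toFinite _).image _).subset h2

/-- `K` has finitely many vertices and edges, and each of them is eventually captured. -/
lemma IsExhaustion.eventually_le {H : ℕ → G.Subgraph} (hH : IsExhaustion H) {K : G.Subgraph}
    (hK : K.verts.Finite) : ∀ᶠ n in atTop, K ≤ H n := by
  have hv : ∀ v ∈ K.verts, ∀ᶠ n in atTop, v ∈ (H n).verts := by
    intro v _
    have : v ∈ (⨆ n, H n).verts := by rw [hH.2.2]; trivial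
    simp only [SimpleGraph.Subgraph.verts_iSup, Set.mem_iUnion] at this
    obtain ⟨n, hn⟩ := this
    exact eventually_atTop.2 ⟨n, fun m hm => (hH.1 hm).1 hn⟩
  have he : ∀ e ∈ K.edgeSet, ∀ᶠ n in atTop, e ∈ (H n).edgeSet := by
    intro e he
    have : e ∈ (⨆ n, H n).edgeSet := by
      rw [hH.2.2, SimpleGraph.Subgraph.edgeSet_top]; exact K.edgeSet_subset he
    simp only [SimpleGraph.Subgraph.edgeSet_iSup, Set.mem_iUnion] at this
    obtain ⟨n, hn⟩ := this
    exact eventually_atTop.2 ⟨n, fun m hm => SimpleGraph.Subgraph.edgeSet_mono (hH.1 hm) hn⟩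
  filter_upwards [(hK.eventually_all).2 hv,
    ((finite_edgeSet_of_finite_verts hK).eventually_all).2 he] with n h1 h2
  exact ⟨h1, fun {a b} hab => h2 s(a, b) hab⟩

lemma finite_edist_le (hG : ∀ v, (G.neighborSet v).Finite) (v : V) (r : ℕ) :
    {x | G.edist v x ≤ r}.Finite := by
  induction r with
  | zero =>
    refine (Set.finite_singleton v).subset fun x hx => ?_
    have h : G.edist v x ≤ 0 := hx
    exact (SimpleGraph.edist_eq_zero_iff.1 (nonpos_iff_eq_zero.1 h)).symm
  | succ n ih =>
    refine (ih.union (ih.biUnion fun u _ => hG u)).subset fun x hx => ?_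
    obtain ⟨p, hp⟩ := SimpleGraph.exists_walk_of_edist_ne_top
      (ne_top_of_le_ne_top (ENat.natCast_ne_top (n + 1)) hx)
    have hlen : p.reverse.length ≤ n + 1 := by
      rw [SimpleGraph.Walk.length_reverse]
      have h := hp.trans_le hx
      exact_mod_cast h
    generalize p.reverse = q at hlen
    cases q with
    | nil => left; simp
    | @cons _ u _ hadj q =>
      refine Or.inr (Set.mem_biUnion (x := u) ?_ hadj.symm)
      have h1 := SimpleGraph.edist_le q.reverse
      rw [SimpleGraph.Walk.length_reverse] at h1
      rw [SimpleGraph.Walk.length_cons] at hlen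
      exact h1.trans (by exact_mod_cast (by omega : q.length ≤ n))

lemma finite_edgeBall_verts (hG : ∀ v, (G.neighborSet v).Finite) (e : G.edgeSet) (r : ℕ) :
    (edgeBall G e r).verts.Finite := by
  classical
  have h : {v | v ∈ (e : Sym2 V)}.Finite := by
    obtain ⟨e, he⟩ := e
    induction e with
    | _ a b =>
      refine (Set.toFinite {a, b}).subset fun v hv => ?_
      simpa using hv
  refine (h.biUnion fun v _ => finite_edist_le hG v r).subset ?_
  rintro x ⟨v, hv, hx⟩
  exact Set.mem_biUnion hv hx

lemma isExhaustion_edgeBall (hG : ∀ v, (G.neighborSet v).Finite) (hc : G.Connected)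
    (e : G.edgeSet) : IsExhaustion (edgeBall G e) := by
  refine ⟨fun m n hmn => SimpleGraph.Subgraph.induce_mono le_rfl ?_,
    finite_edgeBall_verts hG e, ?_⟩
  · rintro x ⟨v, hv, hx⟩
    exact ⟨v, hv, hx.trans (by exact_mod_cast hmn)⟩
  · obtain ⟨v, hv⟩ : ∃ v, v ∈ (e : Sym2 V) := by
      obtain ⟨e, he⟩ := e
      induction e with
      | _ a b => exact ⟨a, by simp⟩
    have key : ∀ x n, G.dist v x ≤ n → x ∈ (edgeBall G e n).verts := fun x n h =>
      ⟨v, hv, by rw [← (hc v x).coe_dist_eq_edist]; exact_mod_cast h⟩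
    refine top_le_iff.1 ⟨fun x _ => ?_, fun a b hab => ?_⟩
    · simp only [SimpleGraph.Subgraph.verts_iSup, Set.mem_iUnion]
      exact ⟨_, key x _ le_rfl⟩
    · simp only [SimpleGraph.Subgraph.iSup_adj]
      refine ⟨max (G.dist v a) (G.dist v b), ?_⟩
      exact ⟨key a _ (le_max_left _ _), key b _ (le_max_right _ _), hab⟩

/-- Indicators that differ by less than `1` are equal. So either the bound is trivial, or the
boundary effect is below `1` and along every exhaustion the indicator is eventually frozen at its
value in the ball. -/
lemma GenericWeights.abs_limitMwm_sub_le {w : G.edgeSet → ℝ} (hw : GenericWeights w)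
    (hG : ∀ v, (G.neighborSet v).Finite) (hc : G.Connected) (r : ℕ) (e : G.edgeSet) :
    |(limitMwm G w).indicator (fun _ => (1 : ℝ)) e - mwmIndicator (edgeBall G e r) w e| ≤
      boundaryEffect G r e w := by
  by_cases h1 : 1 ≤ boundaryEffect G r e w
  · exact (abs_indicator_sub_le_one _ _ _).trans h1
  push Not at h1
  have hev : ∀ H : ℕ → G.Subgraph, IsExhaustion H → ∀ᶠ n in atTop,
      mwmIndicator (edgeBall G e r) w e = mwmIndicator (H n) w e := by
    intro H hH
    filter_upwards [hH.eventually_le (finite_edgeBall_verts hG e r)] with n hn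
    have h2 := (hw.abs_sub_le_boundaryEffect
      (finite_edgeSet_of_finite_verts (hH.2.1 n)) hn).trans_lt h1
    by_cases h3 : e ∈ mwm (edgeBall G e r) w <;> by_cases h4 : e ∈ mwm (H n) w <;>
      simp_all [mwmIndicator]
  have : e ∈ limitMwm G w ↔ e ∈ mwm (edgeBall G e r) w := by
    constructor
    -- `limitMwm` quantifies over all exhaustions; the edge balls provide one to test it on.
    · intro h
      have h2 := h _ (isExhaustion_edgeBall hG hc e)
      have h3 := tendsto_nhds_unique (h2.congr' ((hev _ (isExhaustion_edgeBall hG hc e)).mono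
        fun n hn => hn.symm)) tendsto_const_nhds
      by_contra h4
      simp [mwmIndicator, h4] at h3
    · intro h H hH
      refine tendsto_const_nhds.congr' ((hev H hH).mono fun n hn => ?_)
      refine Eq.trans ?_ hn
      simp [mwmIndicator, h]
  have h0 : (limitMwm G w).indicator (fun _ => (1 : ℝ)) e = mwmIndicator (edgeBall G e r) w e :=
    indicator_one_congr this
  rw [h0, sub_self, abs_zero]
  exact boundaryEffect_nonneg r e w

/-- On a finite graph the constant sequence `⊤` is an exhaustion, and every exhaustion is eventually
`⊤`. This holds for all weights, generic or not. -/
lemma limitMwm_eq_mwm_top [Finite V] (w : G.edgeSet → ℝ) : limitMwm G w = mwm ⊤ w := by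
  ext e
  constructor
  · intro h
    have h2 := h (fun _ => ⊤) ⟨monotone_const, fun _ => Set.toFinite _, by simp⟩
    have h3 := tendsto_nhds_unique h2 tendsto_const_nhds
    by_contra h4
    simp [h4] at h3
  · intro h H hH
    refine tendsto_const_nhds.congr' ?_
    filter_upwards [hH.eventually_le (K := ⊤) (Set.toFinite _)] with n hn
    rw [top_le_iff.1 hn]
    simp [h]

end Matching

/-! ### Transport of matchings and boundary effects along induced embeddings -/

section Transport

variable {U V : Type} {F : SimpleGraph U} {G : SimpleGraph V}

lemma coe_mapEdgeSet (i : F ↪g G) (e : F.edgeSet) :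
    (i.mapEdgeSet e : Sym2 V) = Sym2.map i (e : Sym2 U) := rfl

lemma mem_mapEdgeSet {i : F ↪g G} {e : F.edgeSet} {v : V} :
    v ∈ (i.mapEdgeSet e : Sym2 V) ↔ ∃ u ∈ (e : Sym2 U), i u = v := by
  rw [coe_mapEdgeSet, Sym2.mem_map]

lemma isMatchingOf_map (i : F ↪g G) (K : F.Subgraph) (M : Finset F.edgeSet) :
    IsMatchingOf (K.map i.toHom) (M.map i.mapEdgeSet) ↔ IsMatchingOf K M := by
  have h1 : ∀ e : F.edgeSet, (i.mapEdgeSet e : Sym2 V) ∈ (K.map i.toHom).edgeSet ↔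
      (e : Sym2 U) ∈ K.edgeSet := by
    intro e
    rw [SimpleGraph.Subgraph.edgeSet_map, coe_mapEdgeSet]
    exact (Sym2.map.injective i.injective).mem_set_image
  have h2 : ∀ e f : F.edgeSet, (∃ v : V, v ∈ (i.mapEdgeSet e : Sym2 V) ∧
      v ∈ (i.mapEdgeSet f : Sym2 V)) ↔ ∃ u : U, u ∈ (e : Sym2 U) ∧ u ∈ (f : Sym2 U) := by
    intro e f
    simp only [mem_mapEdgeSet]
    constructor
    · rintro ⟨v, ⟨u, hu, rfl⟩, u', hu', h⟩
      exact ⟨u, hu, i.injective h ▸ hu'⟩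
    · rintro ⟨u, hu, hu'⟩
      exact ⟨i u, ⟨u, hu, rfl⟩, u, hu', rfl⟩
  simp only [IsMatchingOf, Finset.forall_mem_map, h1, h2, ne_eq, EmbeddingLike.apply_eq_iff_eq]

lemma IsMatchingOf.exists_eq_map {i : F ↪g G} {K : F.Subgraph} {M : Finset G.edgeSet}
    (h : IsMatchingOf (K.map i.toHom) M) : ∃ N : Finset F.edgeSet, N.map i.mapEdgeSet = M := by
  classical
  have h1 : ∀ e ∈ M, e ∈ Set.range i.mapEdgeSet := by
    intro e he
    have h2 := h.1 e he
    rw [SimpleGraph.Subgraph.edgeSet_map] at h2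
    obtain ⟨f, hf, hfe⟩ := h2
    exact ⟨⟨f, K.edgeSet_subset hf⟩, Subtype.ext hfe⟩
  obtain ⟨N, hN⟩ := Finset.subset_set_image_iff.1
    (show (M : Set G.edgeSet) ⊆ i.mapEdgeSet '' Set.univ by simpa [Set.subset_def] using h1)
  refine ⟨N, ?_⟩
  rw [← hN.2, Finset.map_eq_image]

lemma isMaxWeightMatching_map (i : F ↪g G) (K : F.Subgraph) (w : G.edgeSet → ℝ)
    (M : Finset F.edgeSet) :
    IsMaxWeightMatching (K.map i.toHom) w (M.map i.mapEdgeSet) ↔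
      IsMaxWeightMatching K (w ∘ i.mapEdgeSet) M := by
  simp only [IsMaxWeightMatching, isMatchingOf_map, Finset.sum_map, Function.comp_apply]
  refine and_congr_right fun _ => ⟨fun h M' hM' => ?_, fun h M' hM' => ?_⟩
  · have := h _ ((isMatchingOf_map i K M').2 hM')
    rwa [Finset.sum_map] at this
  · obtain ⟨N, rfl⟩ := hM'.exists_eq_map
    rw [Finset.sum_map]
    exact h N ((isMatchingOf_map i K N).1 hM')

/-- Matchings of the image subgraph are exactly the images of matchings, with the same weights;
uniqueness of the maximizer is transported too, so no genericity is needed. -/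
lemma mem_mwm_map (i : F ↪g G) (K : F.Subgraph) (w : G.edgeSet → ℝ) (e : F.edgeSet) :
    i.mapEdgeSet e ∈ mwm (K.map i.toHom) w ↔ e ∈ mwm K (w ∘ i.mapEdgeSet) := by
  constructor
  · rintro ⟨M, hM, he⟩
    obtain ⟨N, rfl⟩ := ((hM M).2 rfl).1.exists_eq_map
    refine ⟨N, fun M' => ?_, (Finset.mem_map' _).1 he⟩
    rw [← isMaxWeightMatching_map, hM, Finset.map_inj]
  · rintro ⟨N, hN, he⟩
    refine ⟨N.map i.mapEdgeSet, fun M' => ⟨fun h => ?_, ?_⟩, (Finset.mem_map' _).2 he⟩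
    · obtain ⟨N', rfl⟩ := h.1.exists_eq_map
      rw [isMaxWeightMatching_map] at h
      rw [(hN N').1 h]
    · rintro rfl
      rw [isMaxWeightMatching_map]
      exact (hN N).2 rfl

lemma map_induce_top (i : F ↪g G) (S : Set U) :
    ((⊤ : F.Subgraph).induce S).map i.toHom = (⊤ : G.Subgraph).induce (i '' S) := by
  ext a b
  · simp
  · simp only [SimpleGraph.Subgraph.map_adj, Relation.Map, SimpleGraph.Subgraph.induce_adj,
      SimpleGraph.Subgraph.top_adj]
    constructor
    · rintro ⟨x, y, ⟨hx, hy, h⟩, rfl, rfl⟩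
      exact ⟨⟨x, hx, rfl⟩, ⟨y, hy, rfl⟩, i.map_adj_iff.2 h⟩
    · rintro ⟨⟨x, hx, rfl⟩, ⟨y, hy, rfl⟩, h⟩
      exact ⟨x, y, ⟨hx, hy, i.map_adj_iff.1 h⟩, rfl, rfl⟩

lemma deleteVerts_induce_top (S A : Set V) :
    ((⊤ : G.Subgraph).induce S).deleteVerts A = (⊤ : G.Subgraph).induce (S \ A) := by
  ext a b
  · simp
  · simp only [SimpleGraph.Subgraph.induce_verts,
      SimpleGraph.Subgraph.induce_adj, SimpleGraph.Subgraph.top_adj, Set.mem_sdiff]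
    tauto

/-- The embedding is onto the ball of radius `r` around the image of `u`. -/
def CoversBall (i : F ↪g G) (u : U) (r : ℕ) : Prop :=
  ∀ x, G.edist (i u) x ≤ r → x ∈ Set.range i

/-- A walk of length at most `r` from `i u` never leaves the range of `i`, so it lifts to `F`;
conversely walks map forward. -/
lemma CoversBall.edist_le_iff {i : F ↪g G} {u : U} {r : ℕ} (h : CoversBall i u r) (x : U) :
    G.edist (i u) (i x) ≤ r ↔ F.edist u x ≤ r := by
  constructor
  · intro hx
    obtain ⟨p, hp⟩ := SimpleGraph.exists_walk_of_edist_ne_top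
      (ne_top_of_le_ne_top (ENat.natCast_ne_top r) hx)
    -- The start `a` is kept separate from `i u` so that the walk can be destructed. In the
    -- inductive step the `n`-ball around the next vertex lies in the covered `(n + 1)`-ball around
    -- `u`.
    have key : ∀ (n : ℕ) (u : U) (a : V) (p : G.Walk a (i x)), a = i u → p.length ≤ n →
        CoversBall i u n → F.edist u x ≤ n := by
      intro n
      induction n with
      | zero =>
        rintro u a p rfl hp -
        have : i u = i x := SimpleGraph.Walk.eq_of_length_eq_zero (Nat.le_zero.1 hp)
        simp [i.injective this]
      | succ n ih =>
        rintro u a p rfl hp hc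
        generalize hb : i x = b at p
        cases p with
        | nil => simp [i.injective hb]
        | @cons _ v _ hadj q =>
          obtain ⟨v, rfl⟩ := hc v ((SimpleGraph.edist_eq_one_iff_adj.2 hadj).trans_le
            (by exact_mod_cast Nat.le_add_left 1 n))
          subst hb
          rw [SimpleGraph.Walk.length_cons] at hp
          have h1 := ih v _ q rfl (by omega) fun y hy => hc y <| by
            refine SimpleGraph.edist_triangle.trans
              ((add_le_add (SimpleGraph.edist_eq_one_iff_adj.2 hadj).le hy).trans ?_)
            push_cast
            rw [add_comm]
          refine SimpleGraph.edist_triangle.trans ((add_le_add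
            (SimpleGraph.edist_eq_one_iff_adj.2 (i.map_adj_iff.1 hadj)).le h1).trans ?_)
          push_cast
          rw [add_comm]
    exact key r u _ p rfl (by exact_mod_cast hp.trans_le hx) h
  · intro hx
    obtain ⟨p, hp⟩ := SimpleGraph.exists_walk_of_edist_ne_top
      (ne_top_of_le_ne_top (ENat.natCast_ne_top r) hx)
    have h1 := SimpleGraph.edist_le (p.map i.toHom)
    rw [SimpleGraph.Walk.length_map, hp] at h1
    exact h1.trans hx

lemma CoversBall.mono {i : F ↪g G} {u : U} {r s : ℕ} (hrs : r ≤ s) (h : CoversBall i u s) :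
    CoversBall i u r := fun x hx => h x (hx.trans (by exact_mod_cast hrs))

lemma image_edgeBall_verts {i : F ↪g G} {e : F.edgeSet} {r : ℕ}
    (h : ∀ u ∈ (e : Sym2 U), CoversBall i u r) :
    i '' (edgeBall F e r).verts = (edgeBall G (i.mapEdgeSet e) r).verts := by
  ext x
  constructor
  · rintro ⟨y, ⟨u, hu, hy⟩, rfl⟩
    exact ⟨i u, mem_mapEdgeSet.2 ⟨u, hu, rfl⟩, ((h u hu).edist_le_iff y).2 hy⟩
  · rintro ⟨v, hv, hx⟩
    obtain ⟨u, hu, rfl⟩ := mem_mapEdgeSet.1 hv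
    obtain ⟨y, rfl⟩ := h u hu x hx
    exact ⟨y, ⟨u, hu, ((h u hu).edist_le_iff y).1 hx⟩, rfl⟩

lemma edgeBall_map {i : F ↪g G} {e : F.edgeSet} {r : ℕ}
    (h : ∀ u ∈ (e : Sym2 U), CoversBall i u r) :
    (edgeBall F e r).map i.toHom = edgeBall G (i.mapEdgeSet e) r :=
  (map_induce_top i _).trans (congrArg _ (image_edgeBall_verts h))

lemma mwmIndicator_edgeBall_map {i : F ↪g G} {e : F.edgeSet} {r : ℕ}
    (h : ∀ u ∈ (e : Sym2 U), CoversBall i u r) (w : G.edgeSet → ℝ) :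
    mwmIndicator (edgeBall G (i.mapEdgeSet e) r) w (i.mapEdgeSet e) =
      mwmIndicator (edgeBall F e r) (w ∘ i.mapEdgeSet) e := by
  rw [← edgeBall_map h]
  exact indicator_one_congr (mem_mwm_map i (edgeBall F e r) w e)

/-- A boundary vertex is detected by a neighbour outside the ball, at distance up to `r + 1` from
`e`. The embedding must therefore cover radius `r + 1`, one more than for the ball itself. -/
lemma image_vertexBoundary_edgeBall {i : F ↪g G} {e : F.edgeSet} {r : ℕ}
    (h : ∀ u ∈ (e : Sym2 U), CoversBall i u (r + 1)) :
    i '' vertexBoundary (edgeBall F e r) = vertexBoundary (edgeBall G (i.mapEdgeSet e) r) := by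
  have h' := image_edgeBall_verts fun u hu => (h u hu).mono (Nat.le_succ r)
  ext x
  constructor
  · rintro ⟨y, ⟨hy, z, hz, hyz⟩, rfl⟩
    refine ⟨h' ▸ Set.mem_image_of_mem i hy, i z, ?_, i.map_adj_iff.2 hyz⟩
    rw [← h']
    exact fun hz' => hz (i.injective.mem_set_image.1 hz')
  · rintro ⟨hx, z, hz, hxz⟩
    rw [← h'] at hx hz
    obtain ⟨y, hy, rfl⟩ := hx
    obtain ⟨u, hu, huy⟩ := hy
    obtain ⟨z, rfl⟩ := h u hu z <| by
      refine SimpleGraph.edist_triangle.trans ((add_le_add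
        (((h u hu).mono (Nat.le_succ r)).edist_le_iff y |>.2 huy)
        (SimpleGraph.edist_eq_one_iff_adj.2 hxz).le).trans ?_)
      push_cast
      rfl
    exact ⟨y, ⟨⟨u, hu, huy⟩, z, fun hz' => hz (Set.mem_image_of_mem i hz'),
      i.map_adj_iff.1 hxz⟩, rfl⟩

lemma mwmIndicator_edgeBall_deleteVerts_map {i : F ↪g G} {e : F.edgeSet} {r : ℕ}
    (h : ∀ u ∈ (e : Sym2 U), CoversBall i u r) (A : Set U) (w : G.edgeSet → ℝ) :
    mwmIndicator ((edgeBall G (i.mapEdgeSet e) r).deleteVerts (i '' A)) w (i.mapEdgeSet e) =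
      mwmIndicator ((edgeBall F e r).deleteVerts A) (w ∘ i.mapEdgeSet) e := by
  have h1 : ((edgeBall F e r).deleteVerts A).map i.toHom =
      (edgeBall G (i.mapEdgeSet e) r).deleteVerts (i '' A) := by
    have h2 := image_edgeBall_verts h
    unfold edgeBall at h2 ⊢
    rw [deleteVerts_induce_top, deleteVerts_induce_top, map_induce_top,
      Set.image_sdiff i.injective]
    exact congrArg (fun S => (⊤ : G.Subgraph).induce (S \ i '' A)) h2
  rw [← h1]
  exact indicator_one_congr (mem_mwm_map i ((edgeBall F e r).deleteVerts A) w e)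

lemma boundaryEffect_map {i : F ↪g G} {e : F.edgeSet} {r : ℕ}
    (h : ∀ u ∈ (e : Sym2 U), CoversBall i u (r + 1)) (w : G.edgeSet → ℝ) :
    boundaryEffect G r (i.mapEdgeSet e) w = boundaryEffect F r e (w ∘ i.mapEdgeSet) := by
  have h' : ∀ u ∈ (e : Sym2 U), CoversBall i u r := fun u hu => (h u hu).mono (Nat.le_succ r)
  have hb := image_vertexBoundary_edgeBall h
  refine le_antisymm (Real.iSup_le (fun A => ?_) (boundaryEffect_nonneg _ _ _))
    (Real.iSup_le (fun A => ?_) (boundaryEffect_nonneg _ _ _))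
  · obtain ⟨A, hA⟩ := A
    rw [← hb] at hA
    obtain ⟨A', hA', rfl⟩ := Set.subset_image_iff.1 hA
    rw [mwmIndicator_edgeBall_map h', mwmIndicator_edgeBall_deleteVerts_map h']
    exact le_boundaryEffect r e _ hA'
  · rw [← mwmIndicator_edgeBall_map h', ← mwmIndicator_edgeBall_deleteVerts_map h']
    exact le_boundaryEffect r _ w (hb ▸ Set.image_mono A.2)

end Transport

/-! ### Independent weights: genericity, measurability, almost sure limits -/

section Weights

variable {V : Type} {G : SimpleGraph V} (ν : Measure ℝ) [IsProbabilityMeasure ν]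

instance : IsProbabilityMeasure (weightLaw G ν) := by
  unfold weightLaw; infer_instance

lemma weightLaw_map_comp {U : Type} {F : SimpleGraph U} {j : F.edgeSet → G.edgeSet}
    (hj : Function.Injective j) : (weightLaw G ν).map (fun w => w ∘ j) = weightLaw F ν :=
  Measure.map_infinitePi_infinitePi_of_inj (P := fun _ : G.edgeSet => ν) hj

/-- Independent random variables, one of which has an atomless law, almost surely differ. -/
lemma ae_ne_of_indepFun {Ω : Type*} [MeasurableSpace Ω] {P : Measure Ω} [IsProbabilityMeasure P]
    {X Y : Ω → ℝ} (hX : Measurable X) (hY : Measurable Y) (hXY : ProbabilityTheory.IndepFun X Y P)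
    (hν : ∀ x, P.map X {x} = 0) : ∀ᵐ ω ∂P, X ω ≠ Y ω := by
  have hprod := (ProbabilityTheory.indepFun_iff_map_prod_eq_prod_map_map
    hX.aemeasurable hY.aemeasurable).1 hXY
  have hdiag : MeasurableSet {p : ℝ × ℝ | p.1 = p.2} :=
    measurableSet_eq_fun measurable_fst measurable_snd
  have : IsProbabilityMeasure (P.map X) := Measure.isProbabilityMeasure_map hX.aemeasurable
  have : IsProbabilityMeasure (P.map Y) := Measure.isProbabilityMeasure_map hY.aemeasurable
  have hnull : (P.map fun ω => (X ω, Y ω)) {p : ℝ × ℝ | p.1 = p.2} = 0 := by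
    rw [hprod, ← Measure.prod_swap, Measure.map_apply measurable_swap hdiag,
      Measure.measure_prod_null (measurable_swap hdiag)]
    refine Eventually.of_forall fun y => ?_
    refine measure_mono_null (fun x hx => ?_) (hν y)
    exact hx
  rw [Measure.map_apply (hX.prodMk hY) hdiag] at hnull
  rw [ae_iff]
  simpa using hnull

/-- With atomless independent weights, two distinct finite sums of weights almost surely differ. -/
lemma ae_sum_ne_sum_of_mem {ι : Type*} {ν : Measure ℝ} [IsProbabilityMeasure ν]
    (hν : ∀ x, ν {x} = 0) {S T : Finset ι} {e : ι} (heS : e ∈ S) (heT : e ∉ T) :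
    ∀ᵐ w ∂(Measure.infinitePi fun _ : ι => ν), ∑ i ∈ S, w i ≠ ∑ i ∈ T, w i := by
  classical
  -- With these signs, `∑ c i * w i` over `S ∪ T` is the `T`-sum minus the `S`-sum, and `c e = -1`.
  -- Equality of the two sums thus says that `w e` equals a combination of the other weights, which
  -- is independent of it.
  let c : ι → ℝ := fun i => (if i ∈ T then 1 else 0) - if i ∈ S then 1 else 0
  let f : ι → (ι → ℝ) → ℝ := fun i w => c i * w i
  have hf : ∀ i, Measurable (f i) := fun i => (measurable_pi_apply i).const_mul _
  have hind := (ProbabilityTheory.iIndepFun_infinitePi (P := fun _ : ι => ν)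
    (X := fun i x => c i * x) (fun _ => measurable_id.const_mul _)).indepFun_finsetSum_of_notMem
    hf (Finset.notMem_erase e (S ∪ T))
  have hind2 := hind.symm.comp measurable_neg measurable_id
  have hfe : (Neg.neg ∘ f e) = fun w => w e := by
    ext w
    simp [f, c, heS, heT]
  have hAm : Measurable (∑ i ∈ (S ∪ T).erase e, f i) := by
    fun_prop
  have key := ae_ne_of_indepFun (hf e).neg hAm hind2 (fun x => by
    rw [show (-f e) = fun w => w e from hfe, Measure.infinitePi_map_eval]
    exact hν x)
  filter_upwards [key] with w hw heq
  apply hw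
  have h1 := Finset.add_sum_erase (S ∪ T) (fun i => f i w) (Finset.mem_union_left T heS)
  have h2 : ∑ i ∈ S ∪ T, f i w = ∑ i ∈ T, w i - ∑ i ∈ S, w i := by
    simp only [f, c, sub_mul, ite_mul, one_mul, zero_mul, Finset.sum_sub_distrib,
      Finset.sum_ite_mem, Finset.union_inter_cancel_left, Finset.union_inter_cancel_right]
  rw [Pi.neg_apply, Finset.sum_apply]
  linarith

/-- There are countably many pairs of finite edge sets, and in each pair of distinct sets one
contains an edge missing from the other. -/
lemma ae_genericWeights [Countable V] {ν : Measure ℝ} [IsProbabilityMeasure ν]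
    (hν : ∀ x, ν {x} = 0) : ∀ᵐ w ∂(weightLaw G ν), GenericWeights w := by
  have h : ∀ S T : Finset G.edgeSet, S ≠ T →
      ∀ᵐ w ∂(weightLaw G ν), ∑ i ∈ S, w i ≠ ∑ i ∈ T, w i := by
    intro S T hST
    by_cases h : S ⊆ T
    · obtain ⟨e, he, he'⟩ := Finset.exists_of_ssubset (h.ssubset_of_ne hST)
      filter_upwards [ae_sum_ne_sum_of_mem hν he he'] with w hw using hw.symm
    · obtain ⟨e, he, he'⟩ := Finset.not_subset.1 h
      exact ae_sum_ne_sum_of_mem hν he he'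
  have : Countable (Sym2 V) := Quotient.countable
  have h2 : ∀ᵐ w ∂(weightLaw G ν), ∀ S T : Finset G.edgeSet, S ≠ T →
      ∑ i ∈ S, w i ≠ ∑ i ∈ T, w i :=
    ae_all_iff.2 fun S => ae_all_iff.2 fun T => ae_all_iff.2 fun hST => h S T hST
  filter_upwards [h2] with w hw S T hST
  by_contra hne
  exact hw S T hne hST

lemma measurableSet_mem_mwm {H : G.Subgraph} (hH : H.edgeSet.Finite) (e : G.edgeSet) :
    MeasurableSet {w | e ∈ mwm H w} := by
  -- Being the unique maximizer means strictly beating each of the finitely many other matchings, so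
  -- the event is a finite combination of strict linear inequalities.
  have h1 : ∀ w M, (∀ M', IsMaxWeightMatching H w M' ↔ M' = M) ↔
      IsMatchingOf H M ∧ ∀ M', IsMatchingOf H M' → M' ≠ M → ∑ e ∈ M', w e < ∑ e ∈ M, w e := by
    intro w M
    constructor
    · intro h
      have hM := (h M).2 rfl
      refine ⟨hM.1, fun M' hM' hne => lt_of_not_ge fun hge => hne ?_⟩
      exact (h M').1 ⟨hM', fun M'' h'' => (hM.2 M'' h'').trans hge⟩
    · rintro ⟨hM, h⟩ M'
      constructor
      · intro hM'
        by_contra hne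
        exact (h M' hM'.1 hne).not_ge (hM'.2 M hM)
      · rintro rfl
        refine ⟨hM, fun M'' h'' => ?_⟩
        by_cases hne : M'' = M'
        · rw [hne]
        · exact (h M'' h'' hne).le
  have hfin := finite_isMatchingOf hH
  have h2 : {w | e ∈ mwm H w} = ⋃ M ∈ {M | IsMatchingOf H M}, ⋃ (_ : e ∈ M),
      ⋂ M' ∈ {M | IsMatchingOf H M}, ⋂ (_ : M' ≠ M), {w | ∑ e ∈ M', w e < ∑ e ∈ M, w e} := by
    ext w
    simp only [mwm, h1, Set.mem_ofPred_eq, Set.mem_iUnion, Set.mem_iInter, exists_prop]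
    exact ⟨fun ⟨M, ⟨hM, h⟩, he⟩ => ⟨M, hM, he, h⟩, fun ⟨M, hM, he, h⟩ => ⟨M, ⟨hM, h⟩, he⟩⟩
  rw [h2]
  refine .biUnion hfin.countable fun M _ => .iUnion fun _ => .biInter hfin.countable fun M' _ =>
    .iInter fun _ => measurableSet_lt ?_ ?_ <;>
  exact Finset.measurable_sum _ fun i _ => measurable_pi_apply i

lemma measurable_mwmIndicator {H : G.Subgraph} (hH : H.edgeSet.Finite) (e : G.edgeSet) :
    Measurable fun w => mwmIndicator H w e := by
  have h : (fun w => mwmIndicator H w e) = {w | e ∈ mwm H w}.indicator fun _ => (1 : ℝ) :=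
    funext fun w => indicator_one_congr Iff.rfl
  rw [h]
  exact measurable_const.indicator (measurableSet_mem_mwm hH e)

lemma measurable_boundaryEffect (hG : ∀ v, (G.neighborSet v).Finite) (r : ℕ) (e : G.edgeSet) :
    Measurable (boundaryEffect G r e) := by
  have hB := finite_edgeBall_verts hG e r
  have h1 : (vertexBoundary (edgeBall G e r)).Finite := hB.subset fun v hv => hv.1
  have : Finite {A : Set V // A ⊆ vertexBoundary (edgeBall G e r)} := h1.finite_subsets
  refine Measurable.iSup fun A => ?_
  have h2 := measurable_mwmIndicator (finite_edgeSet_of_finite_verts hB) e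
  have h3 := measurable_mwmIndicator (H := (edgeBall G e r).deleteVerts A.1)
    (finite_edgeSet_of_finite_verts (hB.subset (by simp))) e
  exact (h2.sub h3).abs

lemma integrable_boundaryEffect (hG : ∀ v, (G.neighborSet v).Finite) (r : ℕ) (e : G.edgeSet) :
    Integrable (boundaryEffect G r e) (weightLaw G ν) :=
  .of_bound (measurable_boundaryEffect hG r e).aestronglyMeasurable 1 <| .of_forall fun w => by
    rw [Real.norm_of_nonneg (boundaryEffect_nonneg r e w)]
    exact boundaryEffect_le_one r e w

/-- The boundary effect depends only on the weights pulled back to `F`, and these are again i.i.d.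
with law `ν`. -/
lemma corrDefect_map {U : Type} {F : SimpleGraph U} (hF : ∀ v, (F.neighborSet v).Finite)
    {i : F ↪g G} {e : F.edgeSet} {r : ℕ} (h : ∀ u ∈ (e : Sym2 U), CoversBall i u (r + 1)) :
    corrDefect G ν r (i.mapEdgeSet e) = corrDefect F ν r e := by
  have h1 : corrDefect G ν r (i.mapEdgeSet e) =
      ∫ w, boundaryEffect F r e (w ∘ i.mapEdgeSet) ∂(weightLaw G ν) :=
    integral_congr_ae (.of_forall fun w => boundaryEffect_map h w)
  have h2 : corrDefect F ν r e = ∫ w, boundaryEffect F r e w ∂(weightLaw F ν) := rfl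
  rw [h1, h2, ← weightLaw_map_comp ν i.mapEdgeSet.injective, integral_map]
  · exact (measurable_pi_lambda _ fun _ => measurable_pi_apply _).aemeasurable
  · exact (measurable_boundaryEffect hF r e).aestronglyMeasurable

/-- This exhibits the limit matching, defined through uncountably many exhaustions, as an almost
sure limit of measurable indicators. -/
lemma ae_tendsto_mwmIndicator [Countable V] {ν : Measure ℝ} [IsProbabilityMeasure ν]
    (hν : ∀ x, ν {x} = 0) (hG : ∀ v, (G.neighborSet v).Finite) (hc : G.Connected)
    (e : G.edgeSet) (he : Tendsto (fun r : ℕ => corrDefect G ν r e) atTop (𝓝 0)) :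
    ∀ᵐ w ∂(weightLaw G ν), Tendsto (fun r => mwmIndicator (edgeBall G e r) w e) atTop
      (𝓝 ((limitMwm G w).indicator (fun _ => (1 : ℝ)) e)) := by
  -- By Markov's inequality the event that the effect is at least `1` at every radius has
  -- probability at most `corrDefect` at each `r`, hence zero. At a radius where the effect is below
  -- `1`, the status is decided and stays so.
  have h1 : ∀ᵐ w ∂(weightLaw G ν), ∃ r, boundaryEffect G r e w < 1 := by
    rw [ae_iff]
    refine nonpos_iff_eq_zero.1 (ge_of_tendsto' (f := fun r =>
      ENNReal.ofReal (corrDefect G ν r e)) (by simpa using ENNReal.tendsto_ofReal he) fun r => ?_)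
    have h2 := mul_meas_ge_le_integral_of_nonneg (μ := weightLaw G ν)
      (.of_forall fun w => boundaryEffect_nonneg r e w) (integrable_boundaryEffect ν hG r e) 1
    rw [one_mul] at h2
    refine (measure_mono (t := {w | 1 ≤ boundaryEffect G r e w}) fun w hw => ?_).trans ?_
    · simp only [not_exists, not_lt, Set.mem_ofPred_eq] at hw
      exact hw r
    · rw [← ofReal_measureReal]
      exact ENNReal.ofReal_le_ofReal h2
  filter_upwards [h1, ae_genericWeights hν] with w ⟨r, hr⟩ hw
  have key : ∀ a b : Set G.edgeSet, |a.indicator (fun _ => (1 : ℝ)) e -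
      b.indicator (fun _ => (1 : ℝ)) e| < 1 → a.indicator (fun _ => (1 : ℝ)) e =
      b.indicator (fun _ => (1 : ℝ)) e := by
    intro a b h
    by_cases h3 : e ∈ a <;> by_cases h4 : e ∈ b <;> simp_all
  refine tendsto_const_nhds.congr' (eventually_atTop.2 ⟨r, fun s hs => ?_⟩)
  rw [key _ _ ((hw.abs_limitMwm_sub_le hG hc r e).trans_lt hr)]
  refine key _ _ ((hw.abs_sub_le_boundaryEffect (finite_edgeSet_of_finite_verts
    (finite_edgeBall_verts hG e s)) ((isExhaustion_edgeBall hG hc e).1 hs)).trans_lt hr)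

end Weights

/-! ### Marked graphs, the local matching rule, and isomorphic balls -/

section Local

/-- A rooted graph with the given edge marks. -/
abbrev RootedGraph.withMarks (g : RootedGraph) {k : ℕ}
    (m : g.graph.edgeSet → EuclideanSpace ℝ (Fin k)) : MarkedGraph k :=
  { g with mark := m }

/-- The inclusion of the edges of a ball around the root. -/
abbrev RootedGraph.ballEdge (g : RootedGraph) (r : ℝ≥0) :
    (g.ballGraph r).edgeSet ↪ g.graph.edgeSet :=
  (SimpleGraph.Embedding.induce (g.ball r)).mapEdgeSet

/-- The edges that belong to the maximum weight matching of the ball of radius `r` around them. -/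
def localMwm {V : Type} (G : SimpleGraph V) (r : ℕ) (w : G.edgeSet → ℝ) : Set G.edgeSet :=
  {e | e ∈ mwm (edgeBall G e r) w}

lemma localMwm_indicator {V : Type} {G : SimpleGraph V} (r : ℕ) (w : G.edgeSet → ℝ)
    (e : G.edgeSet) : (localMwm G r w).indicator (fun _ => (1 : ℝ)) e =
      mwmIndicator (edgeBall G e r) w e :=
  indicator_one_congr Iff.rfl

instance (g : RootedGraph) : Countable g.V := by
  have h : (⋃ n : ℕ, g.ball n) = Set.univ := Set.eq_univ_of_forall fun v =>
    Set.mem_iUnion.2 ⟨g.graph.dist g.root v, RootedGraph.mem_ball.2 (by simp)⟩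
  rw [← Set.countable_univ_iff, ← h]
  exact Set.countable_iUnion fun n => (g.ball_finite n).countable

instance (g : RootedGraph) : Countable g.graph.edgeSet :=
  have : Countable (Sym2 g.V) := Quotient.countable
  inferInstance

lemma MarkedGraph.dist_le {k : ℕ} {g h : MarkedGraph k} {r : ℝ≥0} (hgh : MarkedBallsClose g h r) :
    dist g h ≤ 1 / (r + 1) :=
  localDist_le hgh

lemma mapEdgeSet_refl {V : Type} {G : SimpleGraph V} (e : G.edgeSet) :
    SimpleGraph.Iso.mapEdgeSet (RelIso.refl G.Adj) e = e :=
  Subtype.ext (congrFun Sym2.map_id e.1)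

lemma markCost_refl {k : ℕ} (g : RootedGraph) {r : ℝ≥0}
    (m m' : g.graph.edgeSet → EuclideanSpace ℝ (Fin k)) :
    markCost (g := g.withMarks m) (h := g.withMarks m') (r := r) (RelIso.refl _) =
      √(∑ᶠ e, ‖m (g.ballEdge r e) - m' (g.ballEdge r e)‖ ^ 2) := by
  refine congrArg Real.sqrt (finsum_congr fun e => ?_)
  exact congrArg (fun f => ‖m (g.ballEdge r e) - m' (g.ballEdge r f)‖ ^ 2) (mapEdgeSet_refl e)

lemma dist_withMarks_le_of_sqrt_le {k : ℕ} (g : RootedGraph) {r : ℝ≥0}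
    {m m' : g.graph.edgeSet → EuclideanSpace ℝ (Fin k)}
    (h : √(∑ᶠ e, ‖m (g.ballEdge r e) - m' (g.ballEdge r e)‖ ^ 2) ≤ 2 ^ (-(r : ℝ))) :
    dist (g.withMarks m) (g.withMarks m') ≤ 1 / (r + 1) :=
  MarkedGraph.dist_le ⟨RelIso.refl _, fun _ hv => hv, (markCost_refl g m m').trans_le h⟩

lemma sqrt_finsum_norm_sq_eq_zero {ι : Type*} {k : ℕ} {m m' : ι → EuclideanSpace ℝ (Fin k)}
    (h : ∀ e, m e = m' e) : √(∑ᶠ e, ‖m e - m' e‖ ^ 2) = 0 := by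
  have : ∀ e, ‖m e - m' e‖ ^ 2 = 0 := fun e => by rw [h e, sub_self, norm_zero]; norm_num
  rw [finsum_congr this, finsum_zero, Real.sqrt_zero]

lemma markedBallsClose_of_eq {k : ℕ} {g h : MarkedGraph k} {r : ℝ≥0}
    (φ : g.ballGraph r ≃g h.ballGraph r) (hφ : PreservesRoot φ)
    (heq : ∀ e, g.ballMark r e = h.ballMark r (φ.mapEdgeSet e)) : MarkedBallsClose g h r := by
  refine ⟨φ, hφ, ?_⟩
  rw [markCost, sqrt_finsum_norm_sq_eq_zero heq]
  positivity

lemma dist_withMarks_le {k : ℕ} (g : RootedGraph) {r : ℝ≥0}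
    {m m' : g.graph.edgeSet → EuclideanSpace ℝ (Fin k)}
    (h : ∀ e, m (g.ballEdge r e) = m' (g.ballEdge r e)) :
    dist (g.withMarks m) (g.withMarks m') ≤ 1 / (r + 1) := by
  refine dist_withMarks_le_of_sqrt_le g ?_
  rw [sqrt_finsum_norm_sq_eq_zero h]
  positivity

/-- The local distance sees the marks of a finite ball up to a small error, so the product topology
on marks is fine enough. Continuity then gives measurability, the edge set being countable. -/
lemma continuous_withMarks {k : ℕ} (g : RootedGraph) :
    Continuous fun m : g.graph.edgeSet → EuclideanSpace ℝ (Fin k) => g.withMarks m := by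
  rw [continuous_iff_continuousAt]
  intro m
  refine Metric.tendsto_nhds.2 fun ε hε => ?_
  obtain ⟨n, hn⟩ := exists_nat_one_div_lt hε
  have hc : Continuous fun m' : g.graph.edgeSet → EuclideanSpace ℝ (Fin k) =>
      √(∑ᶠ e, ‖m' (g.ballEdge n e) - m (g.ballEdge n e)‖ ^ 2) := by
    have : Fintype (g.ballGraph (n : ℝ≥0)).edgeSet := Fintype.ofFinite _
    simp only [finsum_eq_sum_of_fintype]
    fun_prop
  have h0 : √(∑ᶠ e, ‖m (g.ballEdge (n : ℝ≥0) e) - m (g.ballEdge n e)‖ ^ 2) <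
      (2 : ℝ) ^ (-((n : ℝ≥0) : ℝ)) := by
    rw [sqrt_finsum_norm_sq_eq_zero fun _ => rfl]
    positivity
  filter_upwards [hc.continuousAt.eventually_lt_const h0] with m' hm'
  exact (dist_withMarks_le_of_sqrt_le g hm'.le).trans_lt (by simpa using hn)

lemma measurable_matchingMarks {V : Type} {G : SimpleGraph V}
    {M : (G.edgeSet → ℝ) → Set G.edgeSet}
    (hM : ∀ e, Measurable fun w => (M w).indicator (fun _ => (1 : ℝ)) e) :
    Measurable fun w => matchingMarks w (M w) := by
  refine measurable_pi_lambda _ fun e => ?_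
  refine (PiLp.continuous_toLp 2 fun _ : Fin 2 => ℝ).measurable.comp
    (measurable_pi_lambda _ fun i => ?_)
  fin_cases i
  · exact measurable_pi_apply e
  · exact hM e

lemma aemeasurable_withMarks (g : RootedGraph) {P : Measure (g.graph.edgeSet → ℝ)}
    {M : (g.graph.edgeSet → ℝ) → Set g.graph.edgeSet}
    (hM : ∀ e, AEMeasurable (fun w => (M w).indicator (fun _ => (1 : ℝ)) e) P) :
    AEMeasurable (fun w => g.withMarks (matchingMarks w (M w))) P := by
  refine (continuous_withMarks g).measurable.comp_aemeasurable
    (aemeasurable_pi_lambda _ fun e => ?_)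
  refine (PiLp.continuous_toLp 2 fun _ : Fin 2 => ℝ).measurable.comp_aemeasurable
    (aemeasurable_pi_lambda _ fun i => ?_)
  fin_cases i
  · exact (measurable_pi_apply e).aemeasurable
  · exact hM e

lemma measurable_localMwm_indicator (g : RootedGraph) (r : ℕ) (e : g.graph.edgeSet) :
    Measurable fun w => (localMwm g.graph r w).indicator (fun _ => (1 : ℝ)) e := by
  simp only [localMwm_indicator]
  exact measurable_mwmIndicator
    (finite_edgeSet_of_finite_verts (finite_edgeBall_verts g.locallyFinite e r)) e

/-! ### Isomorphic balls -/

lemma RootedGraph.mem_ball_of_edist_le {g : RootedGraph} {K r : ℕ} {v x : g.V}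
    (hv : v ∈ g.ball K) (hx : g.graph.edist v x ≤ r) : x ∈ g.ball (K + r : ℕ) := by
  have h1 : g.graph.dist g.root v ≤ K := by
    have := RootedGraph.mem_ball.1 hv
    exact_mod_cast this
  have h2 : g.graph.dist v x ≤ r := by
    rw [← (g.connected v x).coe_dist_eq_edist] at hx
    exact_mod_cast hx
  have h3 := g.connected.dist_triangle (u := g.root) (v := v) (w := x)
  refine RootedGraph.mem_ball.2 ?_
  simp only [NNReal.coe_natCast]
  exact_mod_cast h3.trans (add_le_add h1 h2)

lemma coversBall_induce {g : RootedGraph} {K r : ℕ} {R : ℝ≥0} (hR : (K + r : ℕ) ≤ R)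
    {u : g.ball R} (hu : (u : g.V) ∈ g.ball K) :
    CoversBall (SimpleGraph.Embedding.induce (G := g.graph) (g.ball R)) u r := fun x hx =>
  ⟨⟨x, g.ball_mono hR (RootedGraph.mem_ball_of_edist_le hu hx)⟩, rfl⟩

lemma coversBall_induce_comp {g h : RootedGraph} {K r : ℕ} {R : ℝ≥0} (hR : (K + r : ℕ) ≤ R)
    (φ : g.ballGraph R ≃g h.ballGraph R) (hφ : PreservesRoot φ)
    {u : g.ball R} (hu : (u : g.V) ∈ g.ball K) :
    CoversBall ((SimpleGraph.Embedding.induce (G := h.graph) (h.ball R)).comp φ.toEmbedding)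
      u r := by
  intro x hx
  have h1 : (φ u : h.V) ∈ h.ball K := RootedGraph.mem_ball.2
    ((Nat.cast_le.2 (dist_le_of_preservesRoot φ hφ u)).trans (RootedGraph.mem_ball.1 hu))
  obtain ⟨y, hy⟩ := coversBall_induce hR h1 x hx
  exact ⟨φ.symm y, by simpa using hy⟩

/-- The inclusion of the edges of a ball into those of a bigger ball. -/
abbrev RootedGraph.ballEdgeOfLE (g : RootedGraph) {r s : ℝ≥0} (h : r ≤ s) :
    (g.ballGraph r).edgeSet ↪ (g.ballGraph s).edgeSet :=
  (SimpleGraph.induceHomOfLE g.graph (g.ball_mono h)).mapEdgeSet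

lemma mem_ball_of_mem_ballEdgeOfLE {g : RootedGraph} {r s : ℝ≥0} (h : r ≤ s)
    {e : (g.ballGraph r).edgeSet} {u : g.ball s}
    (hu : u ∈ (g.ballEdgeOfLE h e : Sym2 (g.ball s))) : (u : g.V) ∈ g.ball r := by
  obtain ⟨v, -, rfl⟩ := mem_mapEdgeSet.1 hu
  exact v.2

lemma ballEdge_ballEdgeOfLE {g : RootedGraph} {r s : ℝ≥0} (h : r ≤ s)
    (e : (g.ballGraph r).edgeSet) : g.ballEdge s (g.ballEdgeOfLE h e) = g.ballEdge r e := by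
  obtain ⟨e, he⟩ := e
  induction e with
  | _ a b => rfl

lemma ballEdge_restrictIso {g h : RootedGraph} {r s : ℝ≥0} (hrs : r ≤ s)
    (φ : g.ballGraph s ≃g h.ballGraph s) (hφ : PreservesRoot φ) (e : (g.ballGraph r).edgeSet) :
    h.ballEdge r ((restrictIso hrs φ hφ).mapEdgeSet e) =
      ((SimpleGraph.Embedding.induce (h.ball s)).comp φ.toEmbedding).mapEdgeSet
        (g.ballEdgeOfLE hrs e) := by
  obtain ⟨e, he⟩ := e
  induction e with
  | _ a b => rfl

lemma radius_le (K r : ℕ) : (K : ℝ≥0) ≤ ((K + (r + 1) : ℕ) : ℝ≥0) :=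
  Nat.cast_le.2 (Nat.le_add_right _ _)

lemma radius_le' (K r : ℕ) : ((K + r : ℕ) : ℝ≥0) ≤ ((K + (r + 1) : ℕ) : ℝ≥0) :=
  Nat.cast_le.2 (by omega)

/-- Both defects are computed in one finite graph, the ball of `g` of radius `K + (r + 1)`, embedded
into `g` by inclusion and into `h` through `φ`. Each embedding covers the `(r + 1)`-balls around the
edges of the `K`-ball. -/
lemma corrDefect_restrictIso {g h : RootedGraph} {K r : ℕ}
    (φ : g.ballGraph (K + (r + 1) : ℕ) ≃g h.ballGraph (K + (r + 1) : ℕ)) (hφ : PreservesRoot φ)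
    (ν : Measure ℝ) [IsProbabilityMeasure ν]
    (e : (g.ballGraph K).edgeSet) :
    corrDefect h.graph ν r (h.ballEdge K ((restrictIso (radius_le K r) φ hφ).mapEdgeSet e)) =
      corrDefect g.graph ν r (g.ballEdge K e) := by
  have hfin : ∀ v, ((g.ballGraph (K + (r + 1) : ℕ)).neighborSet v).Finite := fun v => Set.toFinite _
  rw [ballEdge_restrictIso, corrDefect_map ν hfin fun u hu => coversBall_induce_comp le_rfl φ hφ
    (mem_ball_of_mem_ballEdgeOfLE _ hu), ← ballEdge_ballEdgeOfLE (radius_le K r),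
    corrDefect_map ν hfin fun u hu => coversBall_induce le_rfl (mem_ball_of_mem_ballEdgeOfLE _ hu)]

/-- If the weights agree on the large balls, the local rule sees isomorphic weighted `r`-balls
around each edge of the `K`-ball. The marks there agree exactly, with cost zero. -/
lemma markedBallsClose_localMwm {g h : RootedGraph} {K r : ℕ}
    (φ : g.ballGraph (K + (r + 1) : ℕ) ≃g h.ballGraph (K + (r + 1) : ℕ)) (hφ : PreservesRoot φ)
    {w : g.graph.edgeSet → ℝ} {w' : h.graph.edgeSet → ℝ}
    (hw : ∀ e, w' (h.ballEdge _ (φ.mapEdgeSet e)) = w (g.ballEdge _ e)) :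
    MarkedBallsClose (g.withMarks (matchingMarks w (localMwm g.graph r w)))
      (h.withMarks (matchingMarks w' (localMwm h.graph r w'))) K := by
  refine markedBallsClose_of_eq (restrictIso (radius_le K r) φ hφ)
    (preservesRoot_restrictIso _ φ hφ) fun e => ?_
  have h1 : ((SimpleGraph.Embedding.induce (h.ball (K + (r + 1) : ℕ))).comp
      φ.toEmbedding).mapEdgeSet = fun e => h.ballEdge _ (φ.mapEdgeSet e) := by
    funext ⟨e, he⟩
    induction e with
    | _ a b => rfl
  have h2 : w' ∘ ((SimpleGraph.Embedding.induce (h.ball (K + (r + 1) : ℕ))).comp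
      φ.toEmbedding).mapEdgeSet = w ∘ g.ballEdge (K + (r + 1) : ℕ) := by
    rw [h1]
    exact funext hw
  change matchingMarks w (localMwm g.graph r w) (g.ballEdge K e) =
    matchingMarks w' (localMwm h.graph r w')
      (h.ballEdge K ((restrictIso (radius_le K r) φ hφ).mapEdgeSet e))
  unfold matchingMarks
  rw [localMwm_indicator, localMwm_indicator, ballEdge_restrictIso,
    ← ballEdge_ballEdgeOfLE (radius_le K r),
    mwmIndicator_edgeBall_map fun u hu => coversBall_induce_comp (radius_le' K r) φ hφ
      (mem_ball_of_mem_ballEdgeOfLE _ hu),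
    mwmIndicator_edgeBall_map fun u hu => coversBall_induce (radius_le' K r)
      (mem_ball_of_mem_ballEdgeOfLE _ hu), h2]
  congr 2
  exact (congrFun h2 _).symm

/-- Isomorphisms restrict to smaller balls, so failure at radius `r` excludes every larger radius
and forces the distance to be at least `1 / (r + 1)`. -/
lemma ballsIso_of_dist_lt {g h : RootedGraph} {r : ℝ≥0} (hd : dist g h < 1 / (r + 1)) :
    BallsIso g h r := by
  by_contra hn
  refine hd.not_ge (le_localDist (ballsIso_of_lt_one g h one_pos) fun s hs => ?_)
  have hsr : s ≤ r := by
    by_contra! hrs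
    obtain ⟨φ, hφ⟩ := hs
    exact hn ⟨restrictIso hrs.le φ hφ, preservesRoot_restrictIso hrs.le φ hφ⟩
  have : (s : ℝ) ≤ r := by exact_mod_cast hsr
  gcongr

end Local

/-! ### Continuity of the local law and of the defect; the approximation error -/

section Laws

variable (ν : Measure ℝ)

/-- The law of the graph with i.i.d. weights and matchings determined by balls of radius `r`. -/
def localMatchingLaw (r : ℕ) (g : RootedGraph) : Measure (MarkedGraph 2) :=
  (weightLaw g.graph ν).map fun w => g.withMarks (matchingMarks w (localMwm g.graph r w))

/-- The law of the graph with i.i.d. weights and its maximum weight matching. -/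
def matchingLaw (g : RootedGraph) : Measure (MarkedGraph 2) :=
  (weightLaw g.graph ν).map fun w => g.withMarks (matchingMarks w (limitMwm g.graph w))

/-- The truncated sum of the correlation defects of the edges in the ball of radius `K`. -/
def ballDefect (K r : ℕ) (g : RootedGraph) : ℝ :=
  min 1 (∑ᶠ e : (g.ballGraph K).edgeSet, corrDefect g.graph ν r (g.ballEdge K e))

lemma ballDefect_nonneg (K r : ℕ) (g : RootedGraph) : 0 ≤ ballDefect ν K r g :=
  le_min zero_le_one (finsum_nonneg fun _ => corrDefect_nonneg _ _ _)

lemma ballDefect_le_one (K r : ℕ) (g : RootedGraph) : ballDefect ν K r g ≤ 1 :=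
  min_le_left _ _

lemma ballDefect_eq [IsProbabilityMeasure ν] {K r : ℕ} {g h : RootedGraph}
    (hgh : BallsIso g h (K + (r + 1) : ℕ)) :
    ballDefect ν K r g = ballDefect ν K r h := by
  obtain ⟨φ, hφ⟩ := hgh
  refine congrArg (min 1) ?_
  refine finsum_eq_of_bijective _
    (restrictIso (radius_le K r) φ hφ).mapEdgeSet.bijective fun e => ?_
  exact (corrDefect_restrictIso φ hφ ν e).symm

/-- It depends only on the ball of radius `K + (r + 1)`, so it is locally constant. Being also
bounded, it is a valid test function for local weak convergence. -/
lemma continuous_ballDefect [IsProbabilityMeasure ν] (K r : ℕ) : Continuous (ballDefect ν K r) := by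
  refine continuous_iff_continuousAt.2 fun g => ?_
  refine tendsto_const_nhds.congr' ?_
  have hpos : (0 : ℝ) < 1 / (((K + (r + 1) : ℕ) : ℝ≥0) + 1) := by positivity
  filter_upwards [Metric.ball_mem_nhds g hpos] with h hh
  rw [Metric.mem_ball'] at hh
  exact ballDefect_eq ν (ballsIso_of_dist_lt hh)

lemma tendsto_ballDefect {g : RootedGraph} (hg : CorrelationDecay g.graph ν) (K : ℕ) :
    Tendsto (fun r => ballDefect ν K r g) atTop (𝓝 0) := by
  have : Fintype (g.ballGraph (K : ℝ≥0)).edgeSet := Fintype.ofFinite _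
  have h1 : Tendsto (fun r => ∑ e : (g.ballGraph K).edgeSet,
      corrDefect g.graph ν r (g.ballEdge K e)) atTop (𝓝 0) := by
    simpa using tendsto_finsetSum Finset.univ fun e _ => hg (g.ballEdge K e)
  have h2 := (tendsto_const_nhds (x := (1 : ℝ))).min h1
  simpa [ballDefect, finsum_eq_sum_of_fintype] using h2

lemma corrDefect_le_finsum {K r : ℕ} {g : RootedGraph} (e : (g.ballGraph K).edgeSet) :
    corrDefect g.graph ν r (g.ballEdge K e) ≤
      ∑ᶠ e : (g.ballGraph K).edgeSet, corrDefect g.graph ν r (g.ballEdge K e) :=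
  single_le_finsum e (Set.toFinite _) fun _ => corrDefect_nonneg _ _ _

lemma exists_ballEdge_eq {g : RootedGraph} (e : g.graph.edgeSet) :
    ∃ (K : ℕ) (f : (g.ballGraph K).edgeSet), g.ballEdge K f = e := by
  obtain ⟨e, he⟩ := e
  induction e with
  | _ a b =>
    have ha : a ∈ g.ball (max (g.graph.dist g.root a) (g.graph.dist g.root b) : ℕ) :=
      RootedGraph.mem_ball.2 (by simp)
    have hb : b ∈ g.ball (max (g.graph.dist g.root a) (g.graph.dist g.root b) : ℕ) :=
      RootedGraph.mem_ball.2 (by simp)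
    exact ⟨_, ⟨s(⟨a, ha⟩, ⟨b, hb⟩), he⟩, rfl⟩

/-- This trades the edges of a varying graph for a countable family of continuous functions, which
makes correlation decay a Borel event. The truncation at `1` is harmless for convergence to `0`. -/
lemma correlationDecay_iff (g : RootedGraph) : CorrelationDecay g.graph ν ↔
    ∀ K, Tendsto (fun r => ballDefect ν K r g) atTop (𝓝 0) := by
  refine ⟨fun hg K => tendsto_ballDefect ν hg K, fun h e => ?_⟩
  obtain ⟨K, f, rfl⟩ := exists_ballEdge_eq e
  refine tendsto_of_tendsto_of_tendsto_of_le_of_le' tendsto_const_nhds (h K)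
    (.of_forall fun r => corrDefect_nonneg _ _ _) ?_
  filter_upwards [(h K).eventually_lt_const zero_lt_one] with r hr
  have h1 := corrDefect_le_finsum ν (r := r) f
  rcases min_lt_iff.1 hr with h2 | h2
  · exact absurd h2 (lt_irrefl _)
  · rwa [ballDefect, min_eq_right h2.le]

lemma measurableSet_correlationDecay [IsProbabilityMeasure ν] :
    MeasurableSet {g : RootedGraph | CorrelationDecay g.graph ν} := by
  simp only [correlationDecay_iff, Set.ofPred_forall]
  exact .iInter fun K => measurableSet_tendsto _ fun r => (continuous_ballDefect ν K r).measurable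

lemma aemeasurable_local (r : ℕ) (g : RootedGraph) :
    AEMeasurable (fun w => g.withMarks (matchingMarks w (localMwm g.graph r w)))
      (weightLaw g.graph ν) :=
  aemeasurable_withMarks g fun e => (measurable_localMwm_indicator g r e).aemeasurable

lemma integral_localMatchingLaw (r : ℕ) (g : RootedGraph) {f : MarkedGraph 2 → ℝ}
    (hf : Continuous f) : ∫ x, f x ∂(localMatchingLaw ν r g) =
      ∫ w, f (g.withMarks (matchingMarks w (localMwm g.graph r w))) ∂(weightLaw g.graph ν) :=
  integral_map (aemeasurable_local ν r g) hf.measurable.aestronglyMeasurable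

/-- The coupling device: edges of a second graph that correspond to ball edges of the first reuse
their coordinates, and all others get fresh ones. Injectivity keeps the pulled-back weights i.i.d.
-/
lemma exists_injective_sum {α β γ : Type*} {a : γ → α} {b : γ → β} (ha : Function.Injective a)
    (hb : Function.Injective b) :
    ∃ j : β → α ⊕ β, Function.Injective j ∧ ∀ c, j (b c) = Sum.inl (a c) := by
  classical
  let j : β → α ⊕ β := fun y => if h : ∃ c, b c = y then Sum.inl (a h.choose) else Sum.inr y
  have hj1 : ∀ c, j (b c) = Sum.inl (a c) := by
    intro c
    have h : ∃ c', b c' = b c := ⟨c, rfl⟩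
    simp only [j, dif_pos h, hb h.choose_spec]
  have hj2 : ∀ y, (¬ ∃ c, b c = y) → j y = Sum.inr y := fun y h => by simp only [j, dif_neg h]
  refine ⟨j, fun x y hxy => ?_, hj1⟩
  by_cases hx : ∃ c, b c = x <;> by_cases hy : ∃ c, b c = y
  · obtain ⟨x, rfl⟩ := hx
    obtain ⟨y, rfl⟩ := hy
    rw [hj1, hj1] at hxy
    rw [ha (Sum.inl_injective hxy)]
  · obtain ⟨x, rfl⟩ := hx
    rw [hj1, hj2 y hy] at hxy
    cases hxy
  · obtain ⟨y, rfl⟩ := hy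
    rw [hj1, hj2 x hx] at hxy
    cases hxy
  · rw [hj2 x hx, hj2 y hy] at hxy
    exact Sum.inr_injective hxy

variable [IsProbabilityMeasure ν]

instance (r : ℕ) (g : RootedGraph) : IsProbabilityMeasure (localMatchingLaw ν r g) :=
  Measure.isProbabilityMeasure_map (aemeasurable_local ν r g)

lemma exists_bound {X : Type*} {f : X → ℝ} {C : ℝ} (hC : ∀ x y, dist (f x) (f y) ≤ C) :
    ∃ B, ∀ x, ‖f x‖ ≤ B := by
  by_cases hX : Nonempty X
  · obtain ⟨x0⟩ := hX
    refine ⟨C + ‖f x0‖, fun x => ?_⟩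
    have h1 := hC x x0
    rw [dist_eq_norm] at h1
    have := norm_le_norm_add_norm_sub' (f x) (f x0)
    linarith
  · exact ⟨0, fun x => (hX ⟨x⟩).elim⟩

/-- Integrals of a Lipschitz function against the local laws on two graphs with isomorphic balls:
the weights on the two balls are coupled to agree. -/
lemma abs_integral_localMatchingLaw_sub_le {K r : ℕ} {g h : RootedGraph}
    (hgh : BallsIso g h (K + (r + 1) : ℕ)) {f : MarkedGraph 2 → ℝ} {L : ℝ≥0}
    (hf : LipschitzWith L f) {C : ℝ} (hC : ∀ x y, dist (f x) (f y) ≤ C) :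
    |∫ x, f x ∂(localMatchingLaw ν r g) - ∫ x, f x ∂(localMatchingLaw ν r h)| ≤
      L * (1 / (K + 1)) := by
  obtain ⟨φ, hφ⟩ := hgh
  obtain ⟨B, hB⟩ := exists_bound hC
  let R : ℝ≥0 := ((K + (r + 1) : ℕ) : ℝ≥0)
  -- One i.i.d. family carries both graphs: `g` reads it through `Sum.inl`, `h` through `j`, and the
  -- two readings agree on the isomorphic balls.
  let P : Measure (g.graph.edgeSet ⊕ h.graph.edgeSet → ℝ) := Measure.infinitePi fun _ => ν
  obtain ⟨j, hj, hj1⟩ := exists_injective_sum (g.ballEdge R).injective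
    ((h.ballEdge R).injective.comp φ.mapEdgeSet.injective)
  have hg : P.map (fun z e => z (Sum.inl e)) = weightLaw g.graph ν :=
    Measure.map_infinitePi_infinitePi_of_inj (P := fun _ => ν) Sum.inl_injective
  have hh : P.map (fun z e => z (j e)) = weightLaw h.graph ν :=
    Measure.map_infinitePi_infinitePi_of_inj (P := fun _ => ν) hj
  have hmg : Measurable fun (z : g.graph.edgeSet ⊕ h.graph.edgeSet → ℝ) e => z (Sum.inl e) :=
    measurable_pi_lambda _ fun _ => measurable_pi_apply _
  have hmh : Measurable fun (z : g.graph.edgeSet ⊕ h.graph.edgeSet → ℝ) e => z (j e) :=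
    measurable_pi_lambda _ fun _ => measurable_pi_apply _
  have hfm := hf.continuous.measurable
  have ag := aemeasurable_local ν r g
  have ah := aemeasurable_local ν r h
  rw [← hg] at ag
  rw [← hh] at ah
  have agf : AEMeasurable (fun w => f (g.withMarks (matchingMarks w (localMwm g.graph r w))))
    (P.map fun z e => z (Sum.inl e)) := hfm.comp_aemeasurable ag
  have ahf : AEMeasurable (fun w => f (h.withMarks (matchingMarks w (localMwm h.graph r w))))
    (P.map fun z e => z (j e)) := hfm.comp_aemeasurable ah
  rw [integral_localMatchingLaw ν r g hf.continuous, integral_localMatchingLaw ν r h hf.continuous,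
    ← hg, ← hh, integral_map hmg.aemeasurable agf.aestronglyMeasurable,
    integral_map hmh.aemeasurable ahf.aestronglyMeasurable, ← integral_sub]
  · rw [← Real.norm_eq_abs]
    refine (norm_integral_le_of_norm_le_const (C := L * (1 / (K + 1)))
      (.of_forall fun z => ?_)).trans (by simp)
    rw [← dist_eq_norm]
    refine (hf.dist_le_mul _ _).trans (mul_le_mul_of_nonneg_left ?_ L.2)
    refine (MarkedGraph.dist_le (r := (K : ℝ≥0)) (markedBallsClose_localMwm φ hφ fun e => ?_)).trans
      (by simp)
    exact congrArg z (hj1 e)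
  · exact .of_bound (agf.comp_measurable hmg).aestronglyMeasurable B (.of_forall fun z => hB _)
  · exact .of_bound (ahf.comp_measurable hmh).aestronglyMeasurable B (.of_forall fun z => hB _)

lemma continuous_integral_localMatchingLaw (r : ℕ) {f : MarkedGraph 2 → ℝ} {L : ℝ≥0}
    (hf : LipschitzWith L f) {C : ℝ} (hC : ∀ x y, dist (f x) (f y) ≤ C) :
    Continuous fun g => ∫ x, f x ∂(localMatchingLaw ν r g) := by
  refine continuous_iff_continuousAt.2 fun g => Metric.tendsto_nhds.2 fun ε hε => ?_
  have hlim : Tendsto (fun K : ℕ => (L : ℝ) * (1 / ((K : ℝ) + 1))) atTop (𝓝 0) := by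
    simpa using tendsto_one_div_add_atTop_nhds_zero_nat.const_mul (L : ℝ)
  obtain ⟨K, hK⟩ := (hlim.eventually_lt_const hε).exists
  have hpos : (0 : ℝ) < 1 / (((K + (r + 1) : ℕ) : ℝ≥0) + 1) := by positivity
  filter_upwards [Metric.ball_mem_nhds g hpos] with h hh
  exact (abs_integral_localMatchingLaw_sub_le ν (ballsIso_of_dist_lt hh) hf hC).trans_lt hK

variable {ν}

lemma aemeasurable_limit (hν : ∀ x, ν {x} = 0) {g : RootedGraph}
    (hg : CorrelationDecay g.graph ν) :
    AEMeasurable (fun w => g.withMarks (matchingMarks w (limitMwm g.graph w)))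
      (weightLaw g.graph ν) := by
  refine aemeasurable_withMarks g fun e => ?_
  refine aemeasurable_of_tendsto_metrizable_ae atTop (fun r => ?_)
    (ae_tendsto_mwmIndicator hν g.locallyFinite g.connected e (hg e))
  exact (measurable_mwmIndicator (finite_edgeSet_of_finite_verts
    (finite_edgeBall_verts g.locallyFinite e r)) e).aemeasurable

lemma isProbabilityMeasure_matchingLaw (hν : ∀ x, ν {x} = 0) {g : RootedGraph}
    (hg : CorrelationDecay g.graph ν) : IsProbabilityMeasure (matchingLaw ν g) :=
  Measure.isProbabilityMeasure_map (aemeasurable_limit hν hg)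

/-- Let `S w` be the sum of the boundary effects over the `K`-ball. If `S w < 1`, the two matchings
agree on that ball and the marked graphs are within `1 / (K + 1)`; otherwise the oscillation bound
`C` is at most `C * S w`. The mean of `S` is the sum of the defects. -/
lemma abs_integral_matchingLaw_sub_le (hν : ∀ x, ν {x} = 0) {g : RootedGraph}
    (hg : CorrelationDecay g.graph ν) (K r : ℕ) {f : MarkedGraph 2 → ℝ} {L : ℝ≥0}
    (hf : LipschitzWith L f) {C : ℝ} (hC : ∀ x y, dist (f x) (f y) ≤ C) :
    |∫ x, f x ∂(matchingLaw ν g) - ∫ x, f x ∂(localMatchingLaw ν r g)| ≤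
      L * (1 / (K + 1)) + C * ballDefect ν K r g := by
  obtain ⟨B, hB⟩ := exists_bound hC
  have hfm := hf.continuous.measurable
  have : Nonempty (MarkedGraph 2) := ⟨g.withMarks 0⟩
  have hC0 : 0 ≤ C := (dist_nonneg).trans (hC (Classical.arbitrary _) (Classical.arbitrary _))
  have : Fintype (g.ballGraph (K : ℝ≥0)).edgeSet := Fintype.ofFinite _
  have hLK : (0 : ℝ) ≤ L * (1 / (K + 1)) := by positivity
  let S : (g.graph.edgeSet → ℝ) → ℝ := fun w =>
    ∑ e : (g.ballGraph K).edgeSet, boundaryEffect g.graph r (g.ballEdge K e) w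
  have hSint : Integrable S (weightLaw g.graph ν) :=
    integrable_finsetSum _ fun e _ => integrable_boundaryEffect ν g.locallyFinite r _
  have hS : ∫ w, S w ∂(weightLaw g.graph ν) =
      ∑ᶠ e : (g.ballGraph K).edgeSet, corrDefect g.graph ν r (g.ballEdge K e) := by
    rw [finsum_eq_sum_of_fintype,
      integral_finsetSum _ fun e _ => integrable_boundaryEffect ν g.locallyFinite r _]
    rfl
  have hbd : ∀ᵐ w ∂(weightLaw g.graph ν),
      dist (f (g.withMarks (matchingMarks w (limitMwm g.graph w))))
        (f (g.withMarks (matchingMarks w (localMwm g.graph r w)))) ≤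
      L * (1 / (K + 1)) + C * S w := by
    filter_upwards [ae_genericWeights hν] with w hw
    have hS0 : 0 ≤ S w := Finset.sum_nonneg fun e _ => boundaryEffect_nonneg _ _ _
    by_cases h1 : 1 ≤ S w
    · exact (hC _ _).trans (by nlinarith)
    · have h2 : ∀ e, matchingMarks w (limitMwm g.graph w) (g.ballEdge K e) =
          matchingMarks w (localMwm g.graph r w) (g.ballEdge K e) := by
        intro e
        have h3 := (hw.abs_limitMwm_sub_le g.locallyFinite g.connected r (g.ballEdge K e)).trans
          (Finset.single_le_sum (f := fun e : (g.ballGraph K).edgeSet =>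
            boundaryEffect g.graph r (g.ballEdge K e) w)
            (fun e _ => boundaryEffect_nonneg _ _ _) (Finset.mem_univ e))
        have h4 := h3.trans_lt (not_le.1 h1)
        rw [← localMwm_indicator] at h4
        unfold matchingMarks
        congr 2
        generalize limitMwm g.graph w = s at h4 ⊢
        generalize localMwm g.graph r w = t at h4 ⊢
        by_cases hs : g.ballEdge K e ∈ s <;> by_cases ht : g.ballEdge K e ∈ t <;> simp_all
      refine (hf.dist_le_mul _ _).trans ?_
      have h5 := mul_le_mul_of_nonneg_left (dist_withMarks_le (r := (K : ℝ≥0)) g h2) L.2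
      simp only [NNReal.coe_natCast] at h5
      exact h5.trans (le_add_of_nonneg_right (mul_nonneg hC0 hS0))
  have al := hfm.comp_aemeasurable (aemeasurable_local ν r g)
  have ai := hfm.comp_aemeasurable (aemeasurable_limit hν hg)
  have il : Integrable (fun w => f (g.withMarks (matchingMarks w (localMwm g.graph r w))))
    (weightLaw g.graph ν) := .of_bound al.aestronglyMeasurable B (.of_forall fun _ => hB _)
  have ii : Integrable (fun w => f (g.withMarks (matchingMarks w (limitMwm g.graph w))))
    (weightLaw g.graph ν) := .of_bound ai.aestronglyMeasurable B (.of_forall fun _ => hB _)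
  have e1 : ∫ x, f x ∂(matchingLaw ν g) = ∫ w, f (g.withMarks (matchingMarks w
      (limitMwm g.graph w))) ∂(weightLaw g.graph ν) :=
    integral_map (aemeasurable_limit hν hg) hfm.aestronglyMeasurable
  rw [e1, integral_localMatchingLaw ν r g hf.continuous, ← integral_sub ii il, ← Real.norm_eq_abs]
  have b1 := norm_integral_le_of_norm_le ((integrable_const (L * (1 / ((K : ℝ) + 1)))).add
    (hSint.const_mul C)) (hbd.mono fun w hw => (dist_eq_norm _ _).symm.trans_le hw)
  -- The crude bound by `C` accounts for the truncation at `1` in `ballDefect`.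
  have b2 := norm_integral_le_of_norm_le (μ := weightLaw g.graph ν) (integrable_const C)
    (.of_forall fun w => (dist_eq_norm _ _).symm.trans_le
      (hC (g.withMarks (matchingMarks w (limitMwm g.graph w)))
        (g.withMarks (matchingMarks w (localMwm g.graph r w)))))
  rw [integral_add' (integrable_const _) (hSint.const_mul C), integral_const_mul C, hS] at b1
  simp only [integral_const, probReal_univ, smul_eq_mul, one_mul] at b1 b2
  rcases le_total 1 (∑ᶠ e : (g.ballGraph K).edgeSet,
    corrDefect g.graph ν r (g.ballEdge K e)) with h | h
  · rw [ballDefect, min_eq_left h]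
    linarith
  · rw [ballDefect, min_eq_right h]
    exact b1

end Laws

/-! ### Measurability and integration of families of probability measures -/

section General

/-- Closed sets form a π-system generating the Borel sets, and the mass of a closed set is the limit
of integrals of its thickened indicators, which are Lipschitz. -/
lemma measurable_of_forall_lipschitz_integral {X Y : Type*} [MeasurableSpace X]
    [PseudoMetricSpace Y] [MeasurableSpace Y] [BorelSpace Y] {κ : X → Measure Y}
    [∀ x, IsProbabilityMeasure (κ x)]
    (h : ∀ (f : Y → ℝ) (C : ℝ) (L : ℝ≥0), (∀ x y, dist (f x) (f y) ≤ C) → LipschitzWith L f →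
      Measurable fun x => ∫ y, f y ∂(κ x)) : Measurable κ := by
  refine .measure_of_isPiSystem_of_isProbabilityMeasure
    ((BorelSpace.measurable_eq (α := Y)).trans borel_eq_generateFrom_isClosed)
    isPiSystem_isClosed fun F hF => ?_
  have hpos : ∀ n : ℕ, (0 : ℝ) < 1 / ((n : ℝ) + 1) := fun n => Nat.one_div_pos_of_nat
  refine measurable_of_tendsto_metrizable (fun n => ?_) (tendsto_pi_nhds.2 fun x =>
    tendsto_lintegral_thickenedIndicator_of_isClosed (κ x) hF hpos
      tendsto_one_div_add_atTop_nhds_zero_nat)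
  have h1 := h (fun y => (thickenedIndicator (hpos n) F y : ℝ)) 1 _ (fun x y => by
    have hx : (thickenedIndicator (hpos n) F x : ℝ) ≤ 1 := by
      exact_mod_cast thickenedIndicator_le_one (hpos n) F x
    have hy : (thickenedIndicator (hpos n) F y : ℝ) ≤ 1 := by
      exact_mod_cast thickenedIndicator_le_one (hpos n) F y
    rw [Real.dist_eq, abs_le]
    constructor <;> linarith [NNReal.coe_nonneg (thickenedIndicator (hpos n) F x),
      NNReal.coe_nonneg (thickenedIndicator (hpos n) F y)])
    (lipschitzWith_thickenedIndicator (hpos n) F)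
  have h2 : ∀ x, ∫⁻ y, (thickenedIndicator (hpos n) F y : ℝ≥0∞) ∂(κ x) =
      ENNReal.ofReal (∫ y, (thickenedIndicator (hpos n) F y : ℝ) ∂(κ x)) := by
    intro x
    rw [ofReal_integral_eq_lintegral_ofReal (integrable_thickenedIndicator F (hpos n))
      (.of_forall fun y => NNReal.coe_nonneg _)]
    simp
  simp only [h2]
  exact h1.ennreal_ofReal

lemma integral_bind {X Y : Type*} [MeasurableSpace X] [MeasurableSpace Y] {μ : Measure X}
    [IsProbabilityMeasure μ] {κ : X → Measure Y} (hκ : Measurable κ)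
    [∀ x, IsProbabilityMeasure (κ x)] {f : Y → ℝ} (hf : Measurable f) {B : ℝ}
    (hB : ∀ y, ‖f y‖ ≤ B) : ∫ y, f y ∂(μ.bind κ) = ∫ x, ∫ y, f y ∂(κ x) ∂μ := by
  let η : ProbabilityTheory.Kernel X Y := ⟨κ, hκ⟩
  have : ProbabilityTheory.IsMarkovKernel η :=
    ⟨fun x => inferInstanceAs (IsProbabilityMeasure (κ x))⟩
  have h1 : μ.bind κ = Measure.bind μ η := rfl
  have : IsProbabilityMeasure (Measure.bind μ η) := inferInstance
  have h2 : Integrable f (Measure.bind μ η) := .of_bound hf.aestronglyMeasurable B (.of_forall hB)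
  rw [h1]
  rw [Measure.comp_eq_comp_const_apply] at h2 ⊢
  rw [ProbabilityTheory.Kernel.integral_comp h2]
  rfl

end General

/-! ### Averaging over the random graph and passing to the limit -/

section Laws

variable {ν : Measure ℝ}

open Classical in
/-- A version of `matchingLaw` that is a probability measure for every graph. -/
def matchingKernel (ν : Measure ℝ) (g : RootedGraph) : Measure (MarkedGraph 2) :=
  if CorrelationDecay g.graph ν then matchingLaw ν g else localMatchingLaw ν 0 g

lemma matchingKernel_of_correlationDecay {g : RootedGraph} (hg : CorrelationDecay g.graph ν) :
    matchingKernel ν g = matchingLaw ν g := if_pos hg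

lemma ae_matchingKernel_eq {μ : Measure RootedGraph}
    (hμ : ∀ᵐ g ∂μ, CorrelationDecay g.graph ν) : matchingKernel ν =ᵐ[μ] matchingLaw ν :=
  hμ.mono fun _ hg => matchingKernel_of_correlationDecay hg

lemma limitMatchingLaw_eq {μ : Measure RootedGraph}
    (hμ : ∀ᵐ g ∂μ, CorrelationDecay g.graph ν) :
    limitMatchingLaw ν μ = μ.bind (matchingKernel ν) :=
  Measure.bind_congr_right (ae_matchingKernel_eq hμ).symm

lemma norm_ballDefect_le (K r : ℕ) (g : RootedGraph) : ‖ballDefect ν K r g‖ ≤ 1 := by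
  rw [Real.norm_of_nonneg (ballDefect_nonneg ν K r g)]
  exact ballDefect_le_one ν K r g

variable [IsProbabilityMeasure ν]

lemma tendsto_integral_localMatchingLaw (hν : ∀ x, ν {x} = 0) {g : RootedGraph}
    (hg : CorrelationDecay g.graph ν) {f : MarkedGraph 2 → ℝ} {L : ℝ≥0}
    (hf : LipschitzWith L f) {C : ℝ} (hC : ∀ x y, dist (f x) (f y) ≤ C) :
    Tendsto (fun r => ∫ x, f x ∂(localMatchingLaw ν r g)) atTop
      (𝓝 (∫ x, f x ∂(matchingLaw ν g))) := by
  refine Metric.tendsto_nhds.2 fun ε hε => ?_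
  have hlim : Tendsto (fun K : ℕ => (L : ℝ) * (1 / ((K : ℝ) + 1))) atTop (𝓝 0) := by
    simpa using tendsto_one_div_add_atTop_nhds_zero_nat.const_mul (L : ℝ)
  obtain ⟨K, hK⟩ := (hlim.eventually_lt_const (half_pos hε)).exists
  have h1 : Tendsto (fun r => C * ballDefect ν K r g) atTop (𝓝 0) := by
    simpa using (tendsto_ballDefect ν hg K).const_mul C
  filter_upwards [h1.eventually_lt_const (half_pos hε)] with r hr
  rw [dist_comm, Real.dist_eq]
  refine (abs_integral_matchingLaw_sub_le hν hg K r hf hC).trans_lt ?_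
  linarith

lemma isProbabilityMeasure_matchingKernel (hν : ∀ x, ν {x} = 0) (g : RootedGraph) :
    IsProbabilityMeasure (matchingKernel ν g) := by
  unfold matchingKernel
  split_ifs with hg
  · exact isProbabilityMeasure_matchingLaw hν hg
  · infer_instance

lemma measurable_matchingKernel (hν : ∀ x, ν {x} = 0) : Measurable (matchingKernel ν) := by
  classical
  have := isProbabilityMeasure_matchingKernel hν
  refine measurable_of_forall_lipschitz_integral fun f C L hC hf => ?_
  -- On the decay event the integral is the limit in `r` of integrals against local laws, continuous
  -- in `g`; off it the kernel is the local law at radius `0`.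
  refine measurable_of_tendsto_metrizable (f := fun r g => if CorrelationDecay g.graph ν then
    ∫ x, f x ∂(localMatchingLaw ν r g) else ∫ x, f x ∂(localMatchingLaw ν 0 g)) (fun r => ?_)
    (tendsto_pi_nhds.2 fun g => ?_)
  · exact Measurable.ite (measurableSet_correlationDecay ν)
      (continuous_integral_localMatchingLaw ν r hf hC).measurable
      (continuous_integral_localMatchingLaw ν 0 hf hC).measurable
  · by_cases hg : CorrelationDecay g.graph ν
    · simpa only [matchingKernel, if_pos hg] using tendsto_integral_localMatchingLaw hν hg hf hC
    · simpa only [matchingKernel, if_neg hg] using tendsto_const_nhds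

lemma aemeasurable_matchingLaw (hν : ∀ x, ν {x} = 0) {μ : Measure RootedGraph}
    (hμ : ∀ᵐ g ∂μ, CorrelationDecay g.graph ν) : AEMeasurable (matchingLaw ν) μ :=
  ⟨matchingKernel ν, measurable_matchingKernel hν, (ae_matchingKernel_eq hμ).symm⟩

lemma isProbabilityMeasure_limitMatchingLaw (hν : ∀ x, ν {x} = 0) {μ : Measure RootedGraph}
    [IsProbabilityMeasure μ] (hμ : ∀ᵐ g ∂μ, CorrelationDecay g.graph ν) :
    IsProbabilityMeasure (limitMatchingLaw ν μ) := by
  have := isProbabilityMeasure_matchingKernel hν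
  rw [limitMatchingLaw_eq hμ]
  refine ⟨?_⟩
  rw [Measure.bind_apply .univ (measurable_matchingKernel hν).aemeasurable]
  simp

lemma integrable_of_continuous_of_bound {X : Type*} [TopologicalSpace X] [MeasurableSpace X]
    [BorelSpace X] {μ : Measure X} [IsFiniteMeasure μ] {f : X → ℝ} (hf : Continuous f) {B : ℝ}
    (hB : ∀ x, ‖f x‖ ≤ B) : Integrable f μ :=
  .of_bound hf.measurable.aestronglyMeasurable B (.of_forall hB)

lemma norm_integral_le_of_bound {X : Type*} [MeasurableSpace X] {μ : Measure X}
    [IsProbabilityMeasure μ] {f : X → ℝ} {B : ℝ} (hB : ∀ x, ‖f x‖ ≤ B) : ‖∫ x, f x ∂μ‖ ≤ B := by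
  simpa using norm_integral_le_of_norm_le_const (μ := μ) (.of_forall hB)

lemma abs_integral_limitMatchingLaw_sub_le (hν : ∀ x, ν {x} = 0) {μ : Measure RootedGraph}
    [IsProbabilityMeasure μ] (hμ : ∀ᵐ g ∂μ, CorrelationDecay g.graph ν) (K r : ℕ)
    {f : MarkedGraph 2 → ℝ} {L : ℝ≥0}
    (hf : LipschitzWith L f) {C : ℝ} (hC : ∀ x y, dist (f x) (f y) ≤ C) :
    |∫ x, f x ∂(limitMatchingLaw ν μ) - ∫ g, ∫ x, f x ∂(localMatchingLaw ν r g) ∂μ| ≤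
      L * (1 / (K + 1)) + C * ∫ g, ballDefect ν K r g ∂μ := by
  obtain ⟨B, hB⟩ := exists_bound hC
  have := isProbabilityMeasure_matchingKernel hν
  have hD : Integrable (ballDefect ν K r) μ :=
    integrable_of_continuous_of_bound (continuous_ballDefect ν K r) (norm_ballDefect_le K r)
  have hl : Integrable (fun g => ∫ x, f x ∂(localMatchingLaw ν r g)) μ :=
    integrable_of_continuous_of_bound (continuous_integral_localMatchingLaw ν r hf hC)
      fun g => norm_integral_le_of_bound hB
  have hk : Integrable (fun g => ∫ x, f x ∂(matchingKernel ν g)) μ := by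
    refine .of_bound ?_ B (.of_forall fun g => norm_integral_le_of_bound hB)
    refine aestronglyMeasurable_of_tendsto_ae atTop (fun r =>
      (continuous_integral_localMatchingLaw ν r hf hC).measurable.aestronglyMeasurable) ?_
    filter_upwards [hμ] with g hg
    rw [matchingKernel_of_correlationDecay hg]
    exact tendsto_integral_localMatchingLaw hν hg hf hC
  rw [limitMatchingLaw_eq hμ, integral_bind (measurable_matchingKernel hν) hf.continuous.measurable
    hB, ← integral_sub hk hl, ← Real.norm_eq_abs]
  have h1 := norm_integral_le_of_norm_le ((integrable_const (L * (1 / ((K : ℝ) + 1)))).add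
    (hD.const_mul C)) (f := fun g => ∫ x, f x ∂(matchingKernel ν g) -
      ∫ x, f x ∂(localMatchingLaw ν r g)) (hμ.mono fun g hg => by
        rw [Real.norm_eq_abs, matchingKernel_of_correlationDecay hg]
        exact abs_integral_matchingLaw_sub_le hν hg K r hf hC)
  rw [integral_add' (integrable_const _) (hD.const_mul C), integral_const_mul C] at h1
  simpa only [integral_const, probReal_univ, smul_eq_mul, one_mul] using h1

/-- The order of choices is what matters: `K` from the Lipschitz constant, then `r` from the limit
graph alone, then `n`. Decay along the sequence is used only qualitatively, for each `n`. -/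
theorem tendsto_integral_limitMatchingLaw (hν : ∀ x, ν {x} = 0) {μs : ℕ → Measure RootedGraph}
    [∀ n, IsProbabilityMeasure (μs n)] {μ : Measure RootedGraph} [IsProbabilityMeasure μ]
    (hconv : LocallyWeaklyConverges μs μ)
    (hμs : ∀ n, ∀ᵐ g ∂(μs n), CorrelationDecay g.graph ν)
    (hμ : ∀ᵐ g ∂μ, CorrelationDecay g.graph ν) {f : MarkedGraph 2 → ℝ} {L : ℝ≥0}
    (hf : LipschitzWith L f) {C : ℝ} (hC : ∀ x y, dist (f x) (f y) ≤ C) :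
    Tendsto (fun n => ∫ x, f x ∂(limitMatchingLaw ν (μs n))) atTop
      (𝓝 (∫ x, f x ∂(limitMatchingLaw ν μ))) := by
  obtain ⟨B, hB⟩ := exists_bound hC
  refine Metric.tendsto_nhds.2 fun ε hε => ?_
  have hε5 : 0 < ε / 5 := by positivity
  have hlim : Tendsto (fun K : ℕ => (L : ℝ) * (1 / ((K : ℝ) + 1))) atTop (𝓝 0) := by
    simpa using tendsto_one_div_add_atTop_nhds_zero_nat.const_mul (L : ℝ)
  obtain ⟨K, hK⟩ := (hlim.eventually_lt_const hε5).exists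
  have hD : Tendsto (fun r => C * ∫ g, ballDefect ν K r g ∂μ) atTop (𝓝 0) := by
    -- Decay holds only pointwise in the graph; the truncation by `1` supplies the dominating
    -- function.
    have h1 := tendsto_integral_of_dominated_convergence (μ := μ) (F := ballDefect ν K)
      (f := fun _ => 0) (fun _ => (1 : ℝ))
      (fun r => (continuous_ballDefect ν K r).measurable.aestronglyMeasurable)
      (integrable_const 1) (fun r => .of_forall (norm_ballDefect_le K r))
      (hμ.mono fun g hg => tendsto_ballDefect ν hg K)
    simpa using h1.const_mul C
  obtain ⟨r, hr⟩ := (hD.eventually_lt_const hε5).exists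
  -- Weak convergence tested on `ballDefect` carries the bound from `μ` to `μs n`.
  have h2 := (hconv (.ofNormedAddCommGroup _ (continuous_ballDefect ν K r) 1
    (norm_ballDefect_le K r))).const_mul C
  have h3 := hconv (.ofNormedAddCommGroup _ (continuous_integral_localMatchingLaw ν r hf hC) B
    fun g => norm_integral_le_of_bound hB)
  simp only [BoundedContinuousFunction.coe_ofNormedAddCommGroup] at h2 h3
  filter_upwards [h2.eventually_lt_const hr, Metric.tendsto_nhds.1 h3 _ hε5] with n hn2 hn3
  have a1 := abs_integral_limitMatchingLaw_sub_le hν (hμs n) K r hf hC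
  have a2 := abs_integral_limitMatchingLaw_sub_le hν hμ K r hf hC
  rw [Real.dist_eq] at hn3 ⊢
  rw [abs_le] at a1 a2
  rw [abs_lt] at hn3 ⊢
  constructor <;> linarith [a1.1, a1.2, a2.1, a2.2, hn3.1, hn3.2]

/-- For probability measures, bounded Lipschitz test functions determine weak convergence. -/
theorem locallyWeaklyConverges_limitMatchingLaw (hν : ∀ x, ν {x} = 0)
    {μs : ℕ → Measure RootedGraph}
    [∀ n, IsProbabilityMeasure (μs n)] {μ : Measure RootedGraph} [IsProbabilityMeasure μ]
    (hconv : LocallyWeaklyConverges μs μ)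
    (hμs : ∀ n, ∀ᵐ g ∂(μs n), CorrelationDecay g.graph ν)
    (hμ : ∀ᵐ g ∂μ, CorrelationDecay g.graph ν) :
    LocallyWeaklyConverges (fun n => limitMatchingLaw ν (μs n)) (limitMatchingLaw ν μ) := by
  let Ps : ℕ → ProbabilityMeasure (MarkedGraph 2) := fun n =>
    ⟨limitMatchingLaw ν (μs n), isProbabilityMeasure_limitMatchingLaw hν (hμs n)⟩
  let P : ProbabilityMeasure (MarkedGraph 2) :=
    ⟨limitMatchingLaw ν μ, isProbabilityMeasure_limitMatchingLaw hν hμ⟩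
  have h : Tendsto Ps atTop (𝓝 P) := tendsto_iff_forall_lipschitz_integral_tendsto.2 <| by
    rintro f ⟨C, hC⟩ ⟨L, hf⟩
    exact tendsto_integral_limitMatchingLaw hν hconv hμs hμ hf hC
  exact ProbabilityMeasure.tendsto_iff_forall_integral_tendsto.1 h

end Laws

/-! ### Finite graphs as a special case of the limit construction -/

section Finite

variable {ν : Measure ℝ}

/-- Once `r` exceeds all distances from an endpoint of `e`, the ball is everything, its boundary is
empty, and only `A = ∅` competes. -/
lemma correlationDecay_of_finite {V : Type} [Finite V] {G : SimpleGraph V} (hc : G.Connected) :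
    CorrelationDecay G ν := by
  intro e
  obtain ⟨v, hv⟩ : ∃ v, v ∈ (e : Sym2 V) := by
    obtain ⟨e, he⟩ := e
    induction e with
    | _ a b => exact ⟨a, by simp⟩
  have h1 : ∀ᶠ r : ℕ in atTop, ∀ x, G.dist v x ≤ r :=
    eventually_all.2 fun x => eventually_ge_atTop _
  refine tendsto_const_nhds.congr' ?_
  filter_upwards [h1] with r hr
  have h2 : vertexBoundary (edgeBall G e r) = ∅ := by
    refine Set.eq_empty_of_forall_notMem ?_
    rintro x ⟨-, u, hu, -⟩
    refine hu ⟨v, hv, ?_⟩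
    rw [← (hc v u).coe_dist_eq_edist]
    exact_mod_cast hr u
  have h3 : ∀ w, boundaryEffect G r e w = 0 := by
    refine fun w => le_antisymm (Real.iSup_le (fun A => ?_) le_rfl) (boundaryEffect_nonneg _ _ _)
    have : A.1 = ∅ := Set.subset_empty_iff.1 (h2 ▸ A.2)
    rw [this, SimpleGraph.Subgraph.deleteVerts_empty, sub_self, abs_zero]
  exact ((integral_congr_ae (.of_forall h3)).trans (integral_zero _ _)).symm

lemma correlationDecay_ofComponent {V : Type} [Finite V] (G : SimpleGraph V) (o : V) :
    CorrelationDecay (RootedGraph.ofComponent G o).graph ν :=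
  have : Finite (RootedGraph.ofComponent G o).V :=
    inferInstanceAs (Finite (G.connectedComponentMk o))
  correlationDecay_of_finite (RootedGraph.ofComponent G o).connected

/-- The inclusion of the component of `o`. -/
def componentEmbedding {V : Type} [Finite V] (G : SimpleGraph V) (o : V) :
    (RootedGraph.ofComponent G o).graph ↪g G :=
  SimpleGraph.Embedding.induce (G.connectedComponentMk o).supp

/-- The maximum weight matching of a finite graph restricts to that of a component. -/
lemma GenericWeights.mem_mwm_component {V : Type} [Finite V] {G : SimpleGraph V} {o : V}
    {w : G.edgeSet → ℝ} (hw : GenericWeights w)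
    (e : (RootedGraph.ofComponent G o).graph.edgeSet) :
    (componentEmbedding G o).mapEdgeSet e ∈ mwm ⊤ w ↔
      e ∈ mwm ⊤ (w ∘ (componentEmbedding G o).mapEdgeSet) := by
  let C := (G.connectedComponentMk o).supp
  have hmap : (⊤ : (RootedGraph.ofComponent G o).graph.Subgraph).map
      (componentEmbedding G o).toHom = (⊤ : G.Subgraph).induce C := by
    have h1 := map_induce_top (componentEmbedding G o) Set.univ
    have h0 : (⊤ : (RootedGraph.ofComponent G o).graph.Subgraph).induce Set.univ = ⊤ :=
      SimpleGraph.Subgraph.induce_self_verts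
    rw [← h0, h1, Set.image_univ]
    exact congrArg _ Subtype.range_coe
  obtain ⟨A, hA, h⟩ := hw.exists_boundary (S := C) (H := ⊤) (Set.toFinite _) le_top
  -- A component has no neighbour outside itself, so the Markov property deletes nothing.
  have hb : vertexBoundary ((⊤ : G.Subgraph).induce C) = ∅ := by
    refine Set.eq_empty_of_forall_notMem ?_
    rintro x ⟨hx, u, hu, hadj⟩
    exact hu ((SimpleGraph.ConnectedComponent.mem_supp_congr_adj _ hadj).1 hx)
  obtain rfl : A = ∅ := Set.subset_empty_iff.1 (hb ▸ hA)
  rw [SimpleGraph.Subgraph.deleteVerts_empty] at h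
  rw [← mem_mwm_map, hmap]
  refine h _ (mem_induce_top_edgeSet.2 fun v hv => ?_)
  obtain ⟨u, -, rfl⟩ := mem_mapEdgeSet.1 hv
  exact u.2

lemma ofComponent_eq_withMarks {V : Type} [Finite V] {k : ℕ} (G : SimpleGraph V) (o : V)
    (m : G.edgeSet → EuclideanSpace ℝ (Fin k)) : MarkedGraph.ofComponent G o m =
      (RootedGraph.ofComponent G o).withMarks (m ∘ (componentEmbedding G o).mapEdgeSet) := rfl

lemma measurable_ofComponent {V : Type} [Finite V] (G : SimpleGraph V) (o : V) :
    Measurable fun w : G.edgeSet → ℝ =>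
      MarkedGraph.ofComponent G o (matchingMarks w (mwm ⊤ w)) := by
  simp only [ofComponent_eq_withMarks]
  refine (continuous_withMarks _).measurable.comp (measurable_pi_lambda _ fun e => ?_)
  exact (measurable_pi_apply _).comp
    (measurable_matchingMarks fun e => measurable_mwmIndicator (Set.toFinite _) e)

variable [IsProbabilityMeasure ν]

/-- Weights restricted to the component are i.i.d., and for generic weights the matching of the
whole graph restricts to that of the component, which is its limit matching. -/
lemma map_ofComponent_eq_matchingLaw (hν : ∀ x, ν {x} = 0) {V : Type} [Finite V]
    (G : SimpleGraph V) (o : V) :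
    (weightLaw G ν).map (fun w => MarkedGraph.ofComponent G o (matchingMarks w (mwm ⊤ w))) =
      matchingLaw ν (RootedGraph.ofComponent G o) := by
  have hfin : Finite (RootedGraph.ofComponent G o).V :=
    inferInstanceAs (Finite (G.connectedComponentMk o))
  have h1 := weightLaw_map_comp ν (componentEmbedding G o).mapEdgeSet.injective
  have h2 := aemeasurable_limit hν (correlationDecay_ofComponent (ν := ν) G o)
  have hm : Measurable fun w : G.edgeSet → ℝ => w ∘ (componentEmbedding G o).mapEdgeSet :=
    measurable_pi_lambda _ fun _ => measurable_pi_apply _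
  rw [matchingLaw, ← h1] at *
  rw [AEMeasurable.map_map_of_aemeasurable h2 hm.aemeasurable]
  refine Measure.map_congr ?_
  filter_upwards [ae_genericWeights hν] with w hw
  rw [ofComponent_eq_withMarks, Function.comp_apply, limitMwm_eq_mwm_top]
  refine congrArg _ (funext fun e => ?_)
  unfold matchingMarks
  rw [Function.comp_apply, Function.comp_apply, indicator_one_congr (hw.mem_mwm_component e)]

instance (G : FiniteGraph) : IsProbabilityMeasure (uniformVertex G) :=
  ProbabilityTheory.isProbabilityMeasure_uniformOn Set.finite_univ Set.univ_nonempty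

lemma measurable_of_finiteGraph {X : Type*} [MeasurableSpace X] (f : FiniteGraph → X) :
    Measurable f := fun _ _ => trivial

/-- The law of a finite graph rooted at a uniform vertex. -/
def rootedKernel (G : FiniteGraph) : Measure RootedGraph :=
  (uniformVertex G).map fun o => RootedGraph.ofComponent G.2 o

lemma isProbabilityMeasure_rootedKernel (G : FiniteGraph) :
    IsProbabilityMeasure (rootedKernel G) :=
  Measure.isProbabilityMeasure_map (measurable_of_countable _).aemeasurable

lemma isProbabilityMeasure_rootedLaw (γ : Measure FiniteGraph) [IsProbabilityMeasure γ] :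
    IsProbabilityMeasure (rootedLaw γ) := by
  have := isProbabilityMeasure_rootedKernel
  refine ⟨?_⟩
  change γ.bind rootedKernel Set.univ = 1
  rw [Measure.bind_apply .univ (measurable_of_finiteGraph _).aemeasurable]
  simp

variable (ν) in
lemma ae_rootedKernel_correlationDecay (G : FiniteGraph) :
    ∀ᵐ g ∂(rootedKernel G), CorrelationDecay g.graph ν := by
  rw [rootedKernel, ae_map_iff (measurable_of_countable _).aemeasurable
    (measurableSet_correlationDecay ν)]
  exact .of_forall fun o => correlationDecay_ofComponent G.2 o

variable (ν) in
lemma ae_rootedLaw_correlationDecay (γ : Measure FiniteGraph) :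
    ∀ᵐ g ∂(rootedLaw γ), CorrelationDecay g.graph ν := by
  rw [ae_iff]
  change γ.bind rootedKernel _ = 0
  rw [Measure.bind_apply (s := {g : RootedGraph | ¬ CorrelationDecay g.graph ν})
    (measurableSet_correlationDecay ν).compl (measurable_of_finiteGraph _).aemeasurable]
  have h : ∀ G, rootedKernel G {g | ¬ CorrelationDecay g.graph ν} = 0 :=
    fun G => ae_iff.1 (ae_rootedKernel_correlationDecay ν G)
  exact (lintegral_congr h).trans lintegral_zero

/-- Drawing the root and the weights of the whole graph gives the same law as drawing the rooted
component first and then weighting it. The identity is checked for each fixed graph and root, then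
averaged. -/
lemma finiteMatchingLaw_eq_limitMatchingLaw (hν : ∀ x, ν {x} = 0) (γ : Measure FiniteGraph) :
    finiteMatchingLaw ν γ = limitMatchingLaw ν (rootedLaw γ) := by
  have h1 : limitMatchingLaw ν (rootedLaw γ) = γ.bind fun G => (rootedKernel G).bind
      (matchingLaw ν) :=
    Measure.bind_bind (measurable_of_finiteGraph _).aemeasurable
      (aemeasurable_matchingLaw hν (ae_rootedLaw_correlationDecay ν γ))
  rw [h1]
  refine congrArg (Measure.bind γ) (funext fun G => ?_)
  have h2 : (rootedKernel G).bind (matchingLaw ν) =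
      (uniformVertex G).bind fun o => matchingLaw ν (RootedGraph.ofComponent G.2 o) := by
    rw [Measure.bind, Measure.bind, rootedKernel, AEMeasurable.map_map_of_aemeasurable
      (aemeasurable_matchingLaw hν (ae_rootedKernel_correlationDecay ν G))
      (measurable_of_countable _).aemeasurable]
    rfl
  rw [h2]
  have hm : Measurable fun p : Fin (G.1 + 1) × (G.2.edgeSet → ℝ) =>
      MarkedGraph.ofComponent G.2 p.1 (matchingMarks p.2 (mwm ⊤ p.2)) :=
    -- There are finitely many roots, so joint measurability reduces to measurability for each fixed
    -- root.
    measurable_from_prod_countable_right fun o => measurable_ofComponent G.2 o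
  ext s hs
  rw [Measure.map_apply hm hs, Measure.prod_apply (hm hs),
    Measure.bind_apply hs (measurable_of_countable _).aemeasurable]
  refine lintegral_congr fun o => ?_
  rw [← map_ofComponent_eq_matchingLaw hν, Measure.map_apply (measurable_ofComponent G.2 o) hs]
  rfl

end Finite

end LocalMWM

end

theorem mainTheorem4
    -- the common law of the i.i.d. edge weights: nonnegative, with continuous distribution function
    (ν : MeasureTheory.Measure ℝ) [MeasureTheory.IsProbabilityMeasure ν]
    (hatomless : ∀ x : ℝ, ν {x} = 0) (hnonneg : ∀ᵐ x ∂ν, 0 ≤ x)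
    -- the laws of the random finite graphs `G_n`, and the law of `(G, o)`
    (γ : ℕ → MeasureTheory.Measure LocalMWM.FiniteGraph)
    [∀ n, MeasureTheory.IsProbabilityMeasure (γ n)]
    (μ : MeasureTheory.Measure LocalMWM.RootedGraph) [MeasureTheory.IsProbabilityMeasure μ]
    (hconv : LocalMWM.LocallyWeaklyConverges (fun n => LocalMWM.rootedLaw (γ n)) μ)
    (hcd : ∀ᵐ g ∂μ, LocalMWM.CorrelationDecay g.graph ν) :
    -- the laws of the decorated graphs are well-defined probability measures
    (∀ n, MeasureTheory.IsProbabilityMeasure (LocalMWM.finiteMatchingLaw ν (γ n))) ∧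
    MeasureTheory.IsProbabilityMeasure (LocalMWM.limitMatchingLaw ν μ) ∧
    LocalMWM.LocallyWeaklyConverges (fun n => LocalMWM.finiteMatchingLaw ν (γ n))
      (LocalMWM.limitMatchingLaw ν μ) := by
  have h1 := fun n => LocalMWM.isProbabilityMeasure_rootedLaw (γ n)
  have h2 := fun n => LocalMWM.ae_rootedLaw_correlationDecay ν (γ n)
  simp only [LocalMWM.finiteMatchingLaw_eq_limitMatchingLaw hatomless]
  exact ⟨fun n => LocalMWM.isProbabilityMeasure_limitMatchingLaw hatomless (h2 n),
    LocalMWM.isProbabilityMeasure_limitMatchingLaw hatomless hcd,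
    LocalMWM.locallyWeaklyConverges_limitMatchingLaw hatomless hconv h2 hcd⟩
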